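/- Let $\epsilon_0,\delta_0>0$, $\Delta=\{z\in\mathbb C: |z|<\epsilon_0\}$, and let $P:\Delta\to\mathbb R$ and $Q:\Delta\times(-\delta_0,\delta_0)\to\mathbb R$ be $C^\infty$-smooth functions such that (i) $P(0)=0$ and $Q(0,0)=0$; (ii) $P(z_2)=P(|z_2|)$ and $Q(z_2,t)=Q(|z_2|,t)$ for all $z_2\in\Delta$ and $t\in(-\delta_0,\delta_0)$; (iii) $P(z_2)>0$ for all $z_2\in\Delta\setminus\{0\}$; (iv) $P$ vanishes to infinite order at $0$, that is, all partial derivatives of $P$ (with respect to the real coordinates of $\mathbb C=\mathbb R^2$) of all orders are zero at $0$. Let $(M,0)$ be the germ at $0\in\mathbb C^2$ of the real hypersurface $$\mathrm{Re}\, z_1+P(z_2)+(\mathrm{Im}\, z_1)\,Q(z_2,\mathrm{Im}\, z_1)=0 ,$$ and let $\mathrm{Aut}(M,0)$ be its stability group, that is, the set of germs at $0$ of biholomorphisms $f$ between neighbourhoods of $0$ in $\mathbb C^2$ with $f(0)=0$ that map the germ of $M$ into itself. Then $$\mathrm{Aut}(M,0)=\{R_t : t\in\mathbb R\},\qquad R_t(z_1,z_2)=(z_1,e^{it}z_2),$$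 as germs at $0$. -/

import Mathlib

open scoped ContDiff Topology

/-- A real function on a real normed space vanishes to infinite order at `x`:
all its partial derivatives of all orders (including the value itself) are zero at `x`. -/
def VanishesToInfiniteOrderAt {E : Type*} [NormedAddCommGroup E] [NormedSpace ℝ E]
    (P : E → ℝ) (x : E) : Prop :=
  ∀ n : ℕ, iteratedFDeriv ℝ n P x = 0

/-- `f` is, near `p`, a biholomorphism of a neighbourhood of `p` onto a neighbourhood of `f p`:
it is holomorphic near `p` and has a holomorphic two-sided local inverse. -/
def IsLocalBiholomorphismAt (f : ℂ × ℂ → ℂ × ℂ) (p : ℂ × ℂ) : Prop :=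
  AnalyticAt ℂ f p ∧
    ∃ g : ℂ × ℂ → ℂ × ℂ, AnalyticAt ℂ g (f p) ∧
      (∀ᶠ z in 𝓝 p, g (f z) = z) ∧ (∀ᶠ w in 𝓝 (f p), f (g w) = w)

/-- The stability group `Aut(M, p)` of the germ at `p` of a subset `M` of `ℂ²`: the germs at `p`
of biholomorphisms that fix `p` and map (the germ at `p` of) `M` into itself. -/
def stabilityGroup (M : Set (ℂ × ℂ)) (p : ℂ × ℂ) : Set ((𝓝 p).Germ (ℂ × ℂ)) :=
  {F | ∃ f : ℂ × ℂ → ℂ × ℂ, F = (f : (𝓝 p).Germ (ℂ × ℂ)) ∧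
    IsLocalBiholomorphismAt f p ∧ f p = p ∧ ∀ᶠ z in 𝓝 p, z ∈ M → f z ∈ M}

/-- The hypersurface `Re z₁ + P(z₂) + Im z₁ · Q(z₂, Im z₁) = 0`,
over `|z₂| < ε₀`, `|Im z₁| < δ₀`. -/
def graphHypersurface (ε₀ δ₀ : ℝ) (P : ℂ → ℝ) (Q : ℂ → ℝ → ℝ) : Set (ℂ × ℂ) :=
  {z | ‖z.2‖ < ε₀ ∧ |z.1.im| < δ₀ ∧ z.1.re + P z.2 + z.1.im * Q z.2 z.1.im = 0}

/-- The rotationMap `R_t(z₁, z₂) = (z₁, e^{it} z₂)`. -/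
noncomputable def rotationMap (t : ℝ) (z : ℂ × ℂ) : ℂ × ℂ :=
  (z.1, Complex.exp (Complex.I * t) * z.2)

/-! Rotations preserve the hypersurface because `P` and `Q` are radial. For the converse, write an
automorphism as (F₁, F₂) and test it on the points with z₁ = P(z)ζ, where ζ = -1 + τ(i - Q(z,
τP(z))) and τ is a free real parameter. There a power of z₁ has the size of that power of `P`, while
`P` and its derivatives are smaller than every power of |z|. The invariance equation can thus be
read order by order in `P`, each order up to errors flat in z, and holomorphic germs cannot be flat
unless they vanish.

Order zero gives F₁(0,z) = 0. At order one, put H = ∂₁F₁(0,·) and φ = F₂(0,·). Varying τ shows that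
H(0) is real, that Im H is controlled by Q∘φ - Q, and that P∘φ/P tends to H(0), which is positive
since F is invertible. A weighted maximum-type argument for `P` (`not_exists_weighted_descent`) then
forces |φ'(0)| = 1. After a rotation φ'(0) = 1. If φ(z) - z had a leading term cz^m, then H - H(0),
and hence P∘φ/P - H(0), would be O(|z|^m); on a ray along which φ moves inwards this bounds the
decay of log P, which flatness excludes (`not_ratio_isBigO`). So φ = id and H = 1.

At higher order let F₁ - z₁ ≈ z₁^(j+1)α(z₂) and F₂ - z₂ ≈ z₁^jβ(z₂). On the ray z = ru, with L =
P'/P, the equation becomes Re[ξ^j(ξα + Lūβ)] ≈ 0 for every ξ = -1 + iτ. As a polynomial in iτ it may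
be evaluated at 1, giving Lūβ(ru) ≈ 2α(ru) (`sub_two_mul_isLittleO`). Comparing directions u makes
rL(r) converge, whereas flatness provides radii with rL(r) → ∞. Hence α = β = 0, and induction on j
yields F = id. -/

/-! ### Leading terms of holomorphic germs in one variable -/

open Filter Asymptotics in
theorem eq_zero_of_isBigO_pow_succ {c : ℂ} {l : ℕ}
    (h : (fun z : ℂ => c * z ^ l) =O[𝓝 0] fun z => ‖z‖ ^ (l + 1)) : c = 0 := by
  have h1 : (fun z : ℂ => c * z ^ l) =o[𝓝 0] fun z : ℂ => z ^ l := by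
    refine h.trans_isLittleO ?_
    have : (fun z : ℂ => ‖z‖ ^ (l + 1)) =o[𝓝 0] fun z : ℂ => ‖z‖ ^ l :=
      (isLittleO_pow_pow (Nat.lt_succ_self l)).comp_tendsto tendsto_norm_zero
    exact this.trans_isBigO (isBigO_of_le _ fun z => by simp)
  by_contra hc
  have h2 : (fun z : ℂ => z ^ l) =o[𝓝 0] fun z : ℂ => z ^ l :=
    (isLittleO_const_mul_left_iff hc).1 h1
  have h3 : ∀ᶠ z in 𝓝[≠] (0 : ℂ), z ^ l = 0 := by
    have := h2.def (c := 1 / 2) (by norm_num)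
    filter_upwards [this.filter_mono nhdsWithin_le_nhds] with z hz
    have : ‖z ^ l‖ = 0 := by linarith [norm_nonneg (z ^ l)]
    exact norm_eq_zero.1 this
  obtain ⟨z, hz, hz0⟩ := (h3.and self_mem_nhdsWithin).exists
  exact pow_ne_zero _ hz0 hz

open Filter Asymptotics in
theorem AnalyticAt.exists_leading_term {g : ℂ → ℂ} (hg : AnalyticAt ℂ g 0)
    (h0 : ¬ ∀ᶠ z in 𝓝 0, g z = 0) :
    ∃ (l : ℕ) (c : ℂ), c ≠ 0 ∧ (fun z => g z - c * z ^ l) =O[𝓝 0] fun z => ‖z‖ ^ (l + 1) := by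
  obtain ⟨l, q, hq, hq0, hgq⟩ := hg.exists_eventuallyEq_pow_smul_nonzero_iff.2 h0
  refine ⟨l, q 0, hq0, ?_⟩
  have h1 : (fun z => q z - q 0) =O[𝓝 0] fun z : ℂ => z := by
    simpa using hq.differentiableAt.isBigO_sub
  have h2 : (fun z => z ^ l * (q z - q 0)) =O[𝓝 0] fun z : ℂ => z ^ l * z :=
    (isBigO_refl _ _).mul h1
  refine (h2.congr' ?_ EventuallyEq.rfl).trans (isBigO_of_le _ fun z => by simp [pow_succ])
  filter_upwards [hgq] with z hz
  rw [hz]; simp; ring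

open Filter Asymptotics in
theorem isBigO_norm_pow_of_le {m n : ℕ} (h : n ≤ m) {E : Type*} [NormedAddCommGroup E] :
    (fun z : E => ‖z‖ ^ m) =O[𝓝 0] fun z => ‖z‖ ^ n := by
  refine IsBigO.of_bound 1 ?_
  filter_upwards [Metric.ball_mem_nhds (0 : E) one_pos] with z hz
  have : ‖z‖ < 1 := by simpa using hz
  simpa using pow_le_pow_of_le_one (norm_nonneg z) this.le h

open Filter Asymptotics in
/-- An analytic function that vanishes to infinite order is zero. -/
theorem AnalyticAt.eventually_eq_zero_of_isBigO_pow {g : ℂ → ℂ} (hg : AnalyticAt ℂ g 0)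
    (h : ∀ n : ℕ, g =O[𝓝 0] fun z => ‖z‖ ^ n) : ∀ᶠ z in 𝓝 0, g z = 0 := by
  by_contra h0
  obtain ⟨l, c, hc, hcl⟩ := hg.exists_leading_term h0
  exact hc (eq_zero_of_isBigO_pow_succ (by simpa using (h (l + 1)).sub hcl))

/-! ### Taylor expansion along z₁ = 0 -/

/-- The partial derivative with respect to the first variable. -/
noncomputable def partialFst (F : ℂ × ℂ → ℂ) (z : ℂ × ℂ) : ℂ := fderiv ℂ F z (1, 0)

theorem AnalyticAt.partialFst {F : ℂ × ℂ → ℂ} {z : ℂ × ℂ} (h : AnalyticAt ℂ F z) :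
    AnalyticAt ℂ (partialFst F) z := by
  have := h.fderiv
  exact (ContinuousLinearMap.analyticAt (ContinuousLinearMap.apply ℂ ℂ ((1 : ℂ), (0 : ℂ))) _).comp
    this

theorem AnalyticAt.iterate_partialFst {F : ℂ × ℂ → ℂ} {z : ℂ × ℂ} (h : AnalyticAt ℂ F z) (n : ℕ) :
    AnalyticAt ℂ (_root_.partialFst^[n] F) z := by
  induction n generalizing F with
  | zero => exact h
  | succ n ih => exact ih h.partialFst

theorem AnalyticAt.hasDerivAt_partialFst {F : ℂ × ℂ → ℂ} {z : ℂ × ℂ} (h : AnalyticAt ℂ F z) :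
    HasDerivAt (fun w => F (w, z.2)) (_root_.partialFst F z) z.1 := by
  have h1 : HasFDerivAt F (fderiv ℂ F z) (z.1, z.2) := h.differentiableAt.hasFDerivAt
  have h2 : HasDerivAt (fun w : ℂ => (w, z.2)) (1, 0) z.1 :=
    (hasDerivAt_id z.1).prodMk (hasDerivAt_const z.1 z.2)
  exact h1.comp_hasDerivAt z.1 h2

theorem AnalyticAt.comp_zero_snd {F : ℂ × ℂ → ℂ} (h : AnalyticAt ℂ F 0) :
    AnalyticAt ℂ (fun w : ℂ => F (0, w)) 0 := by
  have h2 : AnalyticAt ℂ (fun w : ℂ => ((0 : ℂ), w)) 0 := analyticAt_const.prod analyticAt_id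
  have h3 : AnalyticAt ℂ F ((fun w : ℂ => ((0 : ℂ), w)) 0) := h
  exact h3.comp h2

-- Integration in z₁ gains one power: for fixed z₂ this is the mean value inequality on the disc of
-- radius ‖z₁‖, starting from the zero at z₁ = 0.
open Filter Asymptotics in
theorem isBigO_fst_pow_succ_of_hasDerivAt {G G' : ℂ × ℂ → ℂ} {n : ℕ}
    (hG : ∀ᶠ z in 𝓝 0, HasDerivAt (fun w => G (w, z.2)) (G' z) z.1)
    (h0 : ∀ᶠ w in 𝓝 0, G (0, w) = 0)
    (hG' : G' =O[𝓝 0] fun z => ‖z.1‖ ^ n) : G =O[𝓝 0] fun z => ‖z.1‖ ^ (n + 1) := by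
  obtain ⟨C, hC⟩ := hG'.bound
  have h0' : ∀ᶠ z : ℂ × ℂ in 𝓝 0, G (0, z.2) = 0 :=
    (continuous_snd.tendsto' (0 : ℂ × ℂ) 0 rfl).eventually h0
  obtain ⟨ε, hε, hball⟩ := Metric.eventually_nhds_iff_ball.1 ((hG.and hC).and h0')
  refine IsBigO.of_bound C ?_
  filter_upwards [Metric.ball_mem_nhds (0 : ℂ × ℂ) hε] with z hz
  have hz' : ‖z.1‖ < ε ∧ ‖z.2‖ < ε := by
    simpa [Prod.norm_def] using hz
  have hin : ∀ w ∈ Metric.closedBall (0 : ℂ) ‖z.1‖, (w, z.2) ∈ Metric.ball (0 : ℂ × ℂ) ε := by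
    intro w hw
    have : ‖w‖ ≤ ‖z.1‖ := by simpa using hw
    simp [Prod.norm_def, hz'.2, lt_of_le_of_lt this hz'.1]
  have key := (convex_closedBall (0 : ℂ) ‖z.1‖).norm_image_sub_le_of_norm_hasDerivWithin_le
    (f := fun w => G (w, z.2)) (f' := fun w => G' (w, z.2)) (C := C * ‖z.1‖ ^ n)
    (x := 0) (y := z.1)
    (fun w hw => (hball _ (hin w hw)).1.1.hasDerivWithinAt)
    (fun w hw => by
      have h1 := (hball _ (hin w hw)).1.2
      have h2 : ‖w‖ ≤ ‖z.1‖ := by simpa using hw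
      -- The constant is not known to be nonnegative; if it is negative, the bound itself forces
      -- ‖z₁‖^n = 0 and the estimate degenerates harmlessly.
      have hC0 : 0 ≤ C ∨ C < 0 := le_or_gt 0 C
      rcases hC0 with hC0 | hC0
      · refine h1.trans ?_
        simp only [norm_pow, norm_norm]
        gcongr
      · have h3 := (hball _ (hin z.1 (by simp))).1.2
        have h4 : 0 ≤ C * ‖‖z.1‖ ^ n‖ := (norm_nonneg _).trans h3
        have h6 : ‖z.1‖ ^ n = 0 := by
          have : 0 ≤ ‖z.1‖ ^ n := by positivity
          simp only [norm_pow, norm_norm] at h4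
          nlinarith
        have h7 : ‖w‖ ^ n ≤ ‖z.1‖ ^ n := by gcongr
        have h8 : ‖w‖ ^ n = 0 := le_antisymm (h6 ▸ h7) (by positivity)
        simpa [h8, h6] using h1)
    (by simp) (by simp)
  have hz0 := (hball z hz).2
  simp only [hz0, sub_zero, norm_pow, norm_norm] at key ⊢
  rw [pow_succ, ← mul_assoc]; exact key

open Filter Asymptotics in
/-- Taylor expansion in the first variable, with uniform remainder. -/
theorem AnalyticAt.taylor_fst (n : ℕ) {F : ℂ × ℂ → ℂ} (hF : AnalyticAt ℂ F 0)
    (h : ∀ m < n, ∀ᶠ w in 𝓝 (0 : ℂ), _root_.partialFst^[m] F (0, w) = 0) :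
    (fun z : ℂ × ℂ => F z - z.1 ^ n * (_root_.partialFst^[n] F (0, z.2) / n.factorial))
      =O[𝓝 0] fun z => ‖z.1‖ ^ (n + 1) := by
  induction n generalizing F with
  | zero =>
    refine isBigO_fst_pow_succ_of_hasDerivAt (G' := _root_.partialFst F) ?_ ?_ ?_
    · filter_upwards [hF.eventually_analyticAt] with z hz
      simpa using hz.hasDerivAt_partialFst.sub_const (F (0, z.2))
    · simp
    · simpa using hF.partialFst.continuousAt.isBigO_one ℝ
  | succ n ih =>
    have ih' := ih hF.partialFst (fun m hm => h (m + 1) (by omega))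
    refine isBigO_fst_pow_succ_of_hasDerivAt (G' := fun z => _root_.partialFst F z -
      z.1 ^ n * (_root_.partialFst^[n] (_root_.partialFst F) (0, z.2) / n.factorial)) ?_ ?_ ih'
    · filter_upwards [hF.eventually_analyticAt] with z hz
      have h2 : HasDerivAt (fun w : ℂ => w ^ (n + 1) *
          (_root_.partialFst^[n + 1] F (0, z.2) / (n + 1).factorial))
          (z.1 ^ n * (_root_.partialFst^[n] (_root_.partialFst F) (0, z.2) / n.factorial)) z.1 := by
        have := (hasDerivAt_pow (n + 1) z.1).mul_const
          (_root_.partialFst^[n + 1] F (0, z.2) / (n + 1).factorial)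
        refine this.congr_deriv ?_
        rw [Function.iterate_succ_apply, Nat.factorial_succ]
        push_cast
        have : (n : ℂ) + 1 ≠ 0 := by exact_mod_cast n.succ_ne_zero
        have h3 : (n.factorial : ℂ) ≠ 0 := by exact_mod_cast n.factorial_ne_zero
        field_simp
      exact hz.hasDerivAt_partialFst.sub h2
    · filter_upwards [h 0 (by omega)] with w hw
      simpa using hw

-- Taylor expansion makes `F` flat at the origin. On each complex line t ↦ tz the one-variable
-- statement gives vanishing near t = 0, and the identity theorem carries it to t = 1.
open Filter Asymptotics in
theorem AnalyticAt.eventually_eq_zero_of_partialFst {F : ℂ × ℂ → ℂ} (hF : AnalyticAt ℂ F 0)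
    (h : ∀ n : ℕ, ∀ᶠ w in 𝓝 (0 : ℂ), _root_.partialFst^[n] F (0, w) = 0) :
    ∀ᶠ z in 𝓝 0, F z = 0 := by
  have hflat : ∀ n : ℕ, F =O[𝓝 0] fun z => ‖z‖ ^ n := by
    intro n
    have h1 := hF.taylor_fst n (fun m _ => h m)
    have h2 : F =O[𝓝 0] fun z : ℂ × ℂ => ‖z.1‖ ^ (n + 1) := by
      refine h1.congr' ?_ EventuallyEq.rfl
      filter_upwards [(continuous_snd.tendsto' (0 : ℂ × ℂ) 0 rfl).eventually (h n)] with z hz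
      simp [hz]
    refine (h2.trans (isBigO_of_le _ fun z => ?_)).trans
      (isBigO_norm_pow_of_le (m := n + 1) (Nat.le_succ n))
    simp only [norm_pow, norm_norm]
    gcongr
    exact norm_fst_le z
  obtain ⟨ε, hε, hball⟩ := Metric.eventually_nhds_iff_ball.1 hF.eventually_analyticAt
  filter_upwards [Metric.ball_mem_nhds (0 : ℂ × ℂ) hε] with z hz
  set U : Set ℂ := (fun t : ℂ => t • z) ⁻¹' Metric.ball (0 : ℂ × ℂ) ε with hU
  have hUc : IsPreconnected U := by
    have : Convex ℝ U := by
      have := (convex_ball (0 : ℂ × ℂ) ε).is_linear_preimage (f := fun t : ℂ => t • z)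
        ⟨fun a b => add_smul a b z, fun c a => smul_assoc c a z⟩
      exact this
    exact this.isPreconnected
  have hline : ∀ t : ℂ, AnalyticAt ℂ (fun t : ℂ => t • z) t := fun t => by fun_prop
  have han : AnalyticOnNhd ℂ (fun t : ℂ => F (t • z)) U := fun t ht =>
    AnalyticAt.fun_comp (hball _ ht) (hline t)
  have h0U : (0 : ℂ) ∈ U := by simp [hU, hε]
  have h1U : (1 : ℂ) ∈ U := by simpa [hU] using hz
  have hev : ∀ᶠ t in 𝓝 (0 : ℂ), F (t • z) = 0 := by
    refine (han 0 h0U).eventually_eq_zero_of_isBigO_pow fun n => ?_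
    have h1 := (hflat n).comp_tendsto
      ((hline 0).continuousAt.tendsto.trans (by simp) : Tendsto (fun t : ℂ => t • z) (𝓝 0) (𝓝 0))
    refine h1.trans (IsBigO.of_bound (‖z‖ ^ n) (Eventually.of_forall fun t => ?_))
    simp [norm_smul, mul_pow, mul_comm]
  simpa using han.eqOn_zero_of_preconnected_of_eventuallyEq_zero hUc h0U hev h1U

/-! ### Flat and radial functions -/

-- The mean value inequality on a disc of radius ρ. The bound is uniform in `a` and `b`, so that
-- both points may later vary.
open Filter Asymptotics in
theorem mul_pow_bound_of_fderiv_isBigO {E : Type*} [NormedAddCommGroup E] [NormedSpace ℝ E]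
    {F : ℂ → E} {N : ℕ} (hF : ∀ᶠ z in 𝓝 0, DifferentiableAt ℝ F z)
    (hN : (fun z => fderiv ℝ F z) =O[𝓝 0] fun z => ‖z‖ ^ N) :
    ∃ C ≥ (0 : ℝ), ∃ ε > 0, ∀ ρ < ε, ∀ a b : ℂ, ‖a‖ ≤ ρ → ‖b‖ ≤ ρ →
      ‖F a - F b‖ ≤ C * ρ ^ N * ‖a - b‖ := by
  obtain ⟨C, hC0, hC⟩ := hN.exists_nonneg
  obtain ⟨ε, hε, hball⟩ := Metric.eventually_nhds_iff_ball.1 (hF.and hC.bound)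
  refine ⟨C, hC0, ε, hε, fun ρ hρ a b ha hb => ?_⟩
  refine (convex_closedBall (0 : ℂ) ρ).norm_image_sub_le_of_norm_fderiv_le (𝕜 := ℝ) (f := F)
    (fun z hz => ?_) (fun z hz => ?_) (by simpa using hb) (by simpa using ha)
  · exact (hball z (Metric.closedBall_subset_ball hρ hz)).1
  · refine (hball z (Metric.closedBall_subset_ball hρ hz)).2.trans ?_
    have hz' : ‖z‖ ≤ ρ := by simpa using hz
    simp only [norm_pow, norm_norm]
    gcongr

-- Induction on `N` for all `n` together: a bound on the derivative of order n + 1 integrates to one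
-- more power for the derivative of order n.
open Filter Asymptotics in
theorem VanishesToInfiniteOrderAt.iteratedFDeriv_isBigO {P : ℂ → ℝ}
    (hflat : VanishesToInfiniteOrderAt P 0) (hP : ContDiffAt ℝ ∞ P 0) (N n : ℕ) :
    (fun z => iteratedFDeriv ℝ n P z) =O[𝓝 0] fun z => ‖z‖ ^ N := by
  have hdiff : ∀ n : ℕ, ∀ᶠ z in 𝓝 0, DifferentiableAt ℝ (iteratedFDeriv ℝ n P) z := by
    intro n
    have h1 : ContDiffAt ℝ (n + 1 : ℕ) P 0 := hP.of_le (by exact_mod_cast le_top)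
    filter_upwards [h1.eventually (by simp)] with z hz
    exact hz.differentiableAt_iteratedFDeriv (by exact_mod_cast Nat.lt_succ_self n)
  induction N generalizing n with
  | zero =>
    simpa using (hdiff n).self_of_nhds.continuousAt.isBigO_one ℝ
  | succ N ih =>
    have h1 : (fun z => fderiv ℝ (iteratedFDeriv ℝ n P) z) =O[𝓝 0] fun z => ‖z‖ ^ N := by
      obtain ⟨C, hC⟩ := (ih (n + 1)).bound
      refine IsBigO.of_bound C ?_
      filter_upwards [hC] with z hz
      rwa [norm_fderiv_iteratedFDeriv]
    obtain ⟨C, hC, ε, hε, h⟩ := mul_pow_bound_of_fderiv_isBigO (hdiff n) h1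
    refine IsBigO.of_bound C ?_
    filter_upwards [Metric.ball_mem_nhds (0 : ℂ) hε] with z hz
    have := h ‖z‖ (by simpa using hz) z 0 le_rfl (by simp)
    rw [hflat n, sub_zero, sub_zero, mul_assoc, ← pow_succ] at this
    simpa using this

/-- Radial functions of class `C^∞` near `0`, positive off `0` and flat at `0`. -/
structure IsRadialFlat (P : ℂ → ℝ) : Prop where
  smooth : ContDiffAt ℝ ∞ P 0
  flat : VanishesToInfiniteOrderAt P 0
  radial : ∀ᶠ z in 𝓝 (0 : ℂ), P z = P (‖z‖ : ℝ)
  pos : ∀ᶠ z in 𝓝 (0 : ℂ), z ≠ 0 → 0 < P z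

namespace IsRadialFlat
open Filter Asymptotics

variable {P : ℂ → ℝ}

theorem map_zero (hP : IsRadialFlat P) : P 0 = 0 := by
  have := congrArg (fun m => m ![]) (hP.flat 0)
  simpa using this

theorem eventually_differentiableAt (hP : IsRadialFlat P) :
    ∀ᶠ z in 𝓝 0, DifferentiableAt ℝ P z := by
  have h1 : ContDiffAt ℝ (1 : ℕ) P 0 := hP.smooth.of_le (by exact_mod_cast le_top)
  filter_upwards [h1.eventually (by simp)] with z hz
  exact hz.differentiableAt (by simp)

theorem isBigO_pow (hP : IsRadialFlat P) (N : ℕ) : P =O[𝓝 0] fun z => ‖z‖ ^ N :=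
  ((hP.flat.iteratedFDeriv_isBigO hP.smooth N 0).norm_left.congr_left fun z => by
    rw [norm_iteratedFDeriv_zero]).of_norm_left

theorem fderiv_isBigO_pow (hP : IsRadialFlat P) (N : ℕ) :
    (fun z => fderiv ℝ P z) =O[𝓝 0] fun z => ‖z‖ ^ N :=
  ((hP.flat.iteratedFDeriv_isBigO hP.smooth N 1).norm_left.congr_left fun z => by
    rw [norm_iteratedFDeriv_one]).of_norm_left

theorem fderiv_fderiv_isBigO_pow (hP : IsRadialFlat P) (N : ℕ) :
    (fun z => fderiv ℝ (fderiv ℝ P) z) =O[𝓝 0] fun z => ‖z‖ ^ N :=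
  IsBigO.of_norm_left ((hP.flat.iteratedFDeriv_isBigO hP.smooth N 2).norm_left.congr_left fun z => by
    rw [← norm_iteratedFDeriv_one (𝕜 := ℝ) (f := fderiv ℝ P), norm_iteratedFDeriv_fderiv])

theorem eventually_differentiableAt_fderiv (hP : IsRadialFlat P) :
    ∀ᶠ z in 𝓝 0, DifferentiableAt ℝ (fderiv ℝ P) z := by
  have h1 : ContDiffAt ℝ (2 : ℕ) P 0 := contDiffAt_infty.1 hP.smooth 2
  filter_upwards [h1.eventually (by simp)] with z hz
  exact (hz.fderiv_right (m := 1) (by norm_num)).differentiableAt (by simp)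

/-- Flatness of the gradient gives an arbitrary power of `s` in front of the displacement. When the
displacement is O(P), the error stays negligible after division by `P`. -/
theorem sub_isBigO {X : Type*} {l : Filter X} (hP : IsRadialFlat P) {a b : X → ℂ} {s : X → ℝ}
    (ha : a =O[l] s) (hb : b =O[l] s) (hs : Tendsto s l (𝓝 0)) (N : ℕ) :
    (fun x => P (a x) - P (b x)) =O[l] fun x => s x ^ N * ‖a x - b x‖ := by
  obtain ⟨C, hC, ε, hε, h⟩ := mul_pow_bound_of_fderiv_isBigO hP.eventually_differentiableAt
    (hP.fderiv_isBigO_pow N)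
  obtain ⟨K, hK⟩ := ha.bound
  obtain ⟨K', hK'⟩ := hb.bound
  have hsm : Tendsto (fun x => max K K' * ‖s x‖) l (𝓝 0) := by
    simpa using hs.norm.const_mul (max K K')
  refine IsBigO.of_bound (C * (max K K') ^ N) ?_
  filter_upwards [hK, hK', hsm.eventually_lt_const hε] with x h1 h2 h3
  have := h _ h3 (a x) (b x) (h1.trans (by gcongr; exact le_max_left _ _))
    (h2.trans (by gcongr; exact le_max_right _ _))
  simpa [mul_pow, mul_assoc, mul_left_comm, mul_comm] using this

theorem sub_sub_fderiv_isBigO {X : Type*} {l : Filter X} (hP : IsRadialFlat P) {a b : X → ℂ}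
    {s : X → ℝ} (ha : a =O[l] s) (hb : b =O[l] s) (hs : Tendsto s l (𝓝 0)) (N : ℕ) :
    (fun x => P (a x) - P (b x) - fderiv ℝ P (b x) (a x - b x)) =O[l]
      fun x => s x ^ N * ‖a x - b x‖ ^ 2 := by
  obtain ⟨C, hC, ε, hε, h⟩ := mul_pow_bound_of_fderiv_isBigO hP.eventually_differentiableAt_fderiv
    (hP.fderiv_fderiv_isBigO_pow N)
  obtain ⟨ε', hε', hd⟩ := Metric.eventually_nhds_iff_ball.1 hP.eventually_differentiableAt
  obtain ⟨K, hK⟩ := ha.bound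
  obtain ⟨K', hK'⟩ := hb.bound
  have hsm : Tendsto (fun x => max K K' * ‖s x‖) l (𝓝 0) := by
    simpa using hs.norm.const_mul (max K K')
  refine IsBigO.of_bound (C * (max K K') ^ N) ?_
  filter_upwards [hK, hK', hsm.eventually_lt_const hε, hsm.eventually_lt_const hε']
    with x h1 h2 h3 h4
  have h1' : ‖a x‖ ≤ max K K' * ‖s x‖ := h1.trans (by gcongr; exact le_max_left _ _)
  have h2' : ‖b x‖ ≤ max K K' * ‖s x‖ := h2.trans (by gcongr; exact le_max_right _ _)
  have hseg : ∀ w ∈ segment ℝ (b x) (a x), ‖w‖ ≤ max K K' * ‖s x‖ := fun w hw => by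
    have := (convex_closedBall (0 : ℂ) (max K K' * ‖s x‖)).segment_subset
      (by simpa using h2') (by simpa using h1') hw
    simpa using this
  have key := (convex_segment (𝕜 := ℝ) (b x) (a x)).norm_image_sub_le_of_norm_fderiv_le' (𝕜 := ℝ)
    (f := P) (φ := fderiv ℝ P (b x)) (C := C * (max K K' * ‖s x‖) ^ N * ‖a x - b x‖)
    (fun w hw => hd w (by simpa using (hseg w hw).trans_lt h4))
    (fun w hw => (h _ h3 w (b x) (hseg w hw) h2').trans (by
      have := norm_sub_le_of_mem_segment hw
      have hK0 : 0 ≤ max K K' * ‖s x‖ := (norm_nonneg _).trans h1'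
      gcongr))
    (left_mem_segment ℝ _ _) (right_mem_segment ℝ _ _)
  refine key.trans (le_of_eq ?_)
  simp only [norm_mul, norm_pow, norm_norm]
  ring

theorem map_unit_mul (hP : IsRadialFlat P) : ∀ᶠ z in 𝓝 0, ∀ u : ℂ, ‖u‖ = 1 → P (u * z) = P z := by
  obtain ⟨ε, hε, h⟩ := Metric.eventually_nhds_iff_ball.1 hP.radial
  filter_upwards [Metric.ball_mem_nhds (0 : ℂ) hε] with z hz u hu
  rw [h (u * z) (by simpa [hu] using hz), h z hz]
  simp [hu]

theorem continuousOn (hP : IsRadialFlat P) : ∃ ε > 0, ContinuousOn P (Metric.ball 0 ε) := by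
  obtain ⟨ε, hε, h⟩ := Metric.eventually_nhds_iff_ball.1 hP.eventually_differentiableAt
  exact ⟨ε, hε, fun z hz => (h z hz).continuousAt.continuousWithinAt⟩

/-- The tangential derivative of a radial function is zero: differentiate the constant function θ ↦
P(e^{iθ}r). -/
theorem fderiv_ofReal (hP : IsRadialFlat P) :
    ∀ᶠ r : ℝ in 𝓝[>] 0, ∀ v : ℂ, fderiv ℝ P (r : ℂ) v = v.re * fderiv ℝ P (r : ℂ) 1 := by
  have hc : Tendsto (fun r : ℝ => (r : ℂ)) (𝓝[>] 0) (𝓝 0) :=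
    (Complex.continuous_ofReal.tendsto' 0 0 (by simp)).mono_left nhdsWithin_le_nhds
  filter_upwards [hc.eventually hP.eventually_differentiableAt, hc.eventually hP.map_unit_mul,
    self_mem_nhdsWithin] with r hd hu hr v
  have hr0 : (0 : ℝ) < r := hr
  have h1 : HasDerivAt (fun θ : ℝ => Complex.exp (θ * Complex.I) * r) (Complex.I * r) 0 := by
    have := (((Complex.ofRealCLM.hasDerivAt (x := 0)).mul_const Complex.I).cexp).mul_const (r : ℂ)
    simpa using this
  have h2 : HasFDerivAt P (fderiv ℝ P (r : ℂ)) (Complex.exp ((0 : ℝ) * Complex.I) * r) := by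
    simpa using hd.hasFDerivAt
  have h3 := h2.comp_hasDerivAt (0 : ℝ) h1
  have h4 : (P ∘ fun θ : ℝ => Complex.exp (θ * Complex.I) * r) = fun _ => P r := by
    funext θ
    exact hu _ (Complex.norm_exp_ofReal_mul_I θ)
  rw [h4] at h3
  have h5 : fderiv ℝ P (r : ℂ) (Complex.I * r) = 0 := h3.unique (hasDerivAt_const _ _)
  have h6 : fderiv ℝ P (r : ℂ) Complex.I = 0 := by
    have : Complex.I * r = r • Complex.I := by simp [mul_comm]
    rw [this, map_smul, smul_eq_mul] at h5
    exact (mul_eq_zero.1 h5).resolve_left hr0.ne'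
  have hv : v = v.re • (1 : ℂ) + v.im • Complex.I := by
    simp [Complex.re_add_im]
  conv_lhs => rw [hv]
  rw [map_add, map_smul, map_smul, h6]
  simp

/-- Fix a level P(r₀)w(r₀) > 0. Since Pw → 0, the radii up to r₀ at which Pw reaches this level form
a compact set away from 0. Its least element would descend to a smaller radius at no lower level.
Every growth estimate for `P` below is obtained by a choice of the weight. -/
theorem not_exists_weighted_descent (hP : IsRadialFlat P) {w : ℝ → ℝ}
    (hw : ContinuousOn w (Set.Ioi 0)) (hw0 : ∀ r > 0, 0 < w r)
    (hlim : Tendsto (fun r : ℝ => P r * w r) (𝓝[>] 0) (𝓝 0)) :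
    ¬ ∀ᶠ r : ℝ in 𝓝[>] 0, ∃ s : ℝ, 0 < s ∧ s < r ∧ P r * w r ≤ P s * w s := by
  intro h
  have hc : Tendsto (fun r : ℝ => (r : ℂ)) (𝓝[>] 0) (𝓝 0) :=
    (Complex.continuous_ofReal.tendsto' 0 0 (by simp)).mono_left nhdsWithin_le_nhds
  obtain ⟨ε, hε, hcont⟩ := hP.continuousOn
  have hall := (h.and (hc.eventually hP.pos)).and (hc.eventually (Metric.ball_mem_nhds (0 : ℂ) hε))
  obtain ⟨r₀, hr₀, hsub⟩ := mem_nhdsGT_iff_exists_Ioc_subset.1 hall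
  have hr₀' : (0 : ℝ) < r₀ := hr₀
  have hpos : 0 < P r₀ * w r₀ := by
    have := (hsub (Set.right_mem_Ioc.2 hr₀')).1.2 (by exact_mod_cast hr₀'.ne')
    exact mul_pos this (hw0 r₀ hr₀')
  obtain ⟨δ, hδ, hsubδ⟩ := mem_nhdsGT_iff_exists_Ioc_subset.1 (hlim.eventually_lt_const hpos)
  have hδ' : (0 : ℝ) < δ := hδ
  have hcompact : IsCompact (Set.Icc δ r₀ ∩ (fun r : ℝ => P r * w r) ⁻¹' Set.Ici (P r₀ * w r₀)) := by
    have hcon : ContinuousOn (fun r : ℝ => P r * w r) (Set.Icc δ r₀) := by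
      refine ContinuousOn.mul ?_ (hw.mono fun r hr => lt_of_lt_of_le hδ' hr.1)
      refine hcont.comp Complex.continuous_ofReal.continuousOn fun r hr => ?_
      exact (hsub ⟨lt_of_lt_of_le hδ' hr.1, hr.2⟩).2
    exact isCompact_Icc.of_isClosed_subset
      (hcon.preimage_isClosed_of_isClosed isClosed_Icc isClosed_Ici) Set.inter_subset_left
  have hδr : δ ≤ r₀ := by
    by_contra hlt
    have : P r₀ * w r₀ < P r₀ * w r₀ := hsubδ (⟨hr₀', (not_le.1 hlt).le⟩ : r₀ ∈ Set.Ioc 0 δ)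
    exact lt_irrefl _ this
  obtain ⟨s, hs, hmin⟩ := hcompact.exists_isMinOn ⟨r₀, ⟨hδr, le_rfl⟩, le_refl (P r₀ * w r₀)⟩
    continuousOn_id
  obtain ⟨t, ht0, hts, hle⟩ := (hsub ⟨lt_of_lt_of_le hδ' hs.1.1, hs.1.2⟩).1.1
  have hle' : P r₀ * w r₀ ≤ P t * w t := le_trans hs.2 hle
  by_cases htδ : t ≤ δ
  · have := hsubδ (⟨ht0, htδ⟩ : t ∈ Set.Ioc 0 δ)
    exact absurd hle' (not_le.2 this)
  · have := hmin (⟨⟨(not_le.1 htδ).le, hts.le.trans hs.1.2⟩, hle'⟩ :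
      t ∈ Set.Icc δ r₀ ∩ (fun r : ℝ => P r * w r) ⁻¹' Set.Ici (P r₀ * w r₀))
    exact absurd hts (not_lt.2 this)

theorem tendsto_div_pow (hP : IsRadialFlat P) (N : ℕ) :
    Tendsto (fun r : ℝ => P r * (r ^ N)⁻¹) (𝓝[>] 0) (𝓝 0) := by
  have hc : Tendsto (fun r : ℝ => (r : ℂ)) (𝓝[>] 0) (𝓝 0) :=
    (Complex.continuous_ofReal.tendsto' 0 0 (by simp)).mono_left nhdsWithin_le_nhds
  have h1 := ((hP.isBigO_pow (N + 1)).comp_tendsto hc).mul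
    (isBigO_refl (fun r : ℝ => (r ^ N)⁻¹) (𝓝[>] 0))
  refine h1.trans_tendsto ?_
  have h2 : Tendsto (fun r : ℝ => r) (𝓝[>] 0) (𝓝 0) := tendsto_id.mono_left nhdsWithin_le_nhds
  refine h2.congr' ?_
  filter_upwards [self_mem_nhdsWithin] with r hr
  have hr0 : (0 : ℝ) < r := hr
  simp only [Function.comp, Complex.norm_real, Real.norm_eq_abs, abs_of_pos hr0, pow_succ]
  field_simp

/-- If rP'/P < N held near 0, then P(r)r^(-N) would be nonincreasing, and halving the radius would
be a forbidden descent. So rP'/P is at least any given N at arbitrarily small radii. Only a sequence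
is obtained, since the quotient need not tend to infinity. -/
theorem exists_seq_logDeriv_tendsto (hP : IsRadialFlat P) :
    ∃ r : ℕ → ℝ, Tendsto r atTop (𝓝[>] 0) ∧
      Tendsto (fun n => r n * (fderiv ℝ P (r n : ℂ) 1 / P (r n : ℂ))) atTop atTop := by
  have hc : Tendsto (fun r : ℝ => (r : ℂ)) (𝓝[>] 0) (𝓝 0) :=
    (Complex.continuous_ofReal.tendsto' 0 0 (by simp)).mono_left nhdsWithin_le_nhds
  have key : ∀ N : ℕ, ∃ᶠ r : ℝ in 𝓝[>] 0, (N : ℝ) ≤ r * (fderiv ℝ P (r : ℂ) 1 / P (r : ℂ)) := by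
    intro N hN
    refine hP.not_exists_weighted_descent (w := fun r => (r ^ N)⁻¹) ?_ ?_ (hP.tendsto_div_pow N) ?_
    · exact (continuousOn_pow N).inv₀ fun r hr => pow_ne_zero _ (ne_of_gt hr)
    · intro r hr; positivity
    have hall := (hN.and (hc.eventually hP.pos)).and
      (hc.eventually hP.eventually_differentiableAt)
    obtain ⟨r₀, hr₀, hsub⟩ := mem_nhdsGT_iff_exists_Ioo_subset.1 hall
    have hr₀' : (0 : ℝ) < r₀ := hr₀
    have hder : ∀ r ∈ Set.Ioo 0 r₀, HasDerivAt (fun r : ℝ => P r * (r ^ N)⁻¹)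
        (fderiv ℝ P (r : ℂ) 1 * (r ^ N)⁻¹ + P r * (-(N * r ^ (N - 1)) / (r ^ N) ^ 2)) r := by
      intro r hr
      have h1 : HasDerivAt (fun r : ℝ => P r) (fderiv ℝ P (r : ℂ) 1) r :=
        (hsub hr).2.hasFDerivAt.comp_hasDerivAt r (Complex.ofRealCLM.hasDerivAt (x := r))
      exact h1.mul ((hasDerivAt_pow N r).inv (pow_ne_zero _ hr.1.ne'))
    have hanti : AntitoneOn (fun r : ℝ => P r * (r ^ N)⁻¹) (Set.Ioo 0 r₀) := by
      refine antitoneOn_of_deriv_nonpos (convex_Ioo _ _)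
        (fun r hr => (hder r hr).continuousAt.continuousWithinAt) ?_ ?_
      · rw [interior_Ioo]
        exact fun r hr => (hder r hr).differentiableAt.differentiableWithinAt
      · rw [interior_Ioo]
        intro r hr
        rw [(hder r hr).deriv]
        have hr0 : 0 < r := hr.1
        have hp : 0 < P (r : ℂ) := (hsub hr).1.2 (by exact_mod_cast hr0.ne')
        have hlt := not_le.1 (hsub hr).1.1
        rw [← mul_div_assoc, div_lt_iff₀ hp] at hlt
        have hNeq : (N : ℝ) * r ^ (N - 1) * r = N * r ^ N := by
          rcases N with _ | N
          · simp
          · simp [pow_succ, mul_assoc]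
        have : fderiv ℝ P (r : ℂ) 1 * (r ^ N)⁻¹ + P r * (-(N * r ^ (N - 1)) / (r ^ N) ^ 2)
            = (r * fderiv ℝ P (r : ℂ) 1 - N * P r) * (r ^ (N + 1))⁻¹ := by
          have : (N : ℝ) * r ^ (N - 1) = N * r ^ N * r⁻¹ := by
            rw [← hNeq]; field_simp
          rw [this]
          field_simp
          ring
        rw [this]
        exact mul_nonpos_of_nonpos_of_nonneg (by linarith) (by positivity)
    filter_upwards [Ioo_mem_nhdsGT hr₀'] with r hr
    have hr2 : r / 2 ∈ Set.Ioo 0 r₀ := ⟨by linarith [hr.1], by linarith [hr.1, hr.2]⟩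
    exact ⟨r / 2, hr2.1, by linarith [hr.1], hanti hr2 hr (by linarith [hr.1])⟩
  have h2 : ∀ N : ℕ, ∃ r : ℝ, (0 < r ∧ r < 1 / ((N : ℝ) + 1)) ∧
      (N : ℝ) ≤ r * (fderiv ℝ P (r : ℂ) 1 / P (r : ℂ)) := by
    intro N
    obtain ⟨r, h1, h3⟩ := ((key N).and_eventually (Ioo_mem_nhdsGT
      (show (0 : ℝ) < 1 / ((N : ℝ) + 1) by positivity))).exists
    exact ⟨r, h3, h1⟩
  choose r hr using h2
  refine ⟨r, ?_, tendsto_atTop_mono (fun n => (hr n).2) tendsto_natCast_atTop_atTop⟩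
  refine tendsto_nhdsWithin_iff.2 ⟨?_, Eventually.of_forall fun n => (hr n).1.1⟩
  exact squeeze_zero (fun n => (hr n).1.1.le) (fun n => (hr n).1.2.le)
    tendsto_one_div_add_atTop_nhds_zero_nat

end IsRadialFlat

/-! ### Rays, and holomorphic germs controlled by their real part -/

open Filter Asymptotics in
theorem tendsto_ofReal_mul_punctured {u : ℂ} (hu : u ≠ 0) :
    Tendsto (fun r : ℝ => (r : ℂ) * u) (𝓝[>] 0) (𝓝[≠] 0) := by
  refine tendsto_nhdsWithin_iff.2 ⟨?_, ?_⟩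
  · exact ((Complex.continuous_ofReal.mul continuous_const).tendsto' 0 0 (by simp)).mono_left
      nhdsWithin_le_nhds
  · filter_upwards [self_mem_nhdsWithin] with r hr
    have hr0 : (0 : ℝ) < r := hr
    exact mul_ne_zero (by exact_mod_cast hr0.ne') hu

theorem exists_unit_mul_pow_eq {c w : ℂ} (hc : c ≠ 0) (hw : ‖w‖ = 1) {l : ℕ} (hl : l ≠ 0) :
    ∃ u : ℂ, ‖u‖ = 1 ∧ c * u ^ l = ‖c‖ * w := by
  obtain ⟨u, hu⟩ := IsAlgClosed.exists_pow_nat_eq ((‖c‖ : ℂ) * w / c) (Nat.pos_of_ne_zero hl)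
  refine ⟨u, ?_, ?_⟩
  · have : ‖u‖ ^ l = 1 := by
      rw [← norm_pow, hu]
      simp [hw, hc]
    exact (pow_eq_one_iff_of_nonneg (norm_nonneg u) hl).1 this
  · rw [hu]; field_simp

open Filter Asymptotics in
theorem not_const_mul_pow_isLittleO {c : ℝ} (hc : c ≠ 0) {l : ℕ} {L : Filter ℝ} [L.NeBot]
    (hL : L ≤ 𝓝[>] 0) : ¬ (fun r : ℝ => c * r ^ l) =o[L] fun r => r ^ l := by
  intro h
  have h2 : (fun r : ℝ => r ^ l) =o[L] fun r => r ^ l := (isLittleO_const_mul_left_iff hc).1 h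
  have h3 := h2.def (c := 1 / 2) (by norm_num)
  have h4 : ∀ᶠ r in L, 0 < r := hL self_mem_nhdsWithin
  obtain ⟨r, hr, hr0⟩ := (h3.and h4).exists
  have : 0 < ‖r ^ l‖ := norm_pos_iff.2 (pow_ne_zero _ hr0.ne')
  linarith

open Filter Asymptotics in
/-- The order of vanishing of a holomorphic germ is controlled by its real part. -/
theorem AnalyticAt.isBigO_pow_of_re {g : ℂ → ℂ} (hg : AnalyticAt ℂ g 0) (hg0 : g 0 = 0)
    {q : ℂ → ℝ} (hq : Tendsto q (𝓝[≠] 0) (𝓝 0)) {n : ℕ}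
    (h : (fun z => (g z).re + (g z).im * q z) =O[𝓝[≠] 0] fun z => ‖z‖ ^ n) :
    g =O[𝓝 0] fun z => ‖z‖ ^ n := by
  by_cases hz : ∀ᶠ z in 𝓝 0, g z = 0
  · exact (isBigO_zero (fun z : ℂ => ‖z‖ ^ n) (𝓝 0)).congr'
      (by filter_upwards [hz] with z hz using hz.symm) EventuallyEq.rfl
  obtain ⟨l, c, hc, hcl⟩ := hg.exists_leading_term hz
  have hgl : g =O[𝓝 0] fun z => ‖z‖ ^ l := by
    have h1 : (fun z : ℂ => c * z ^ l) =O[𝓝 0] fun z => ‖z‖ ^ l :=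
      IsBigO.of_bound ‖c‖ (Eventually.of_forall fun z => by simp)
    simpa using (hcl.trans (isBigO_norm_pow_of_le (Nat.le_succ l))).add h1
  by_cases hln : n ≤ l
  · exact hgl.trans (isBigO_norm_pow_of_le hln)
  exfalso
  have hl : l ≠ 0 := by
    rintro rfl
    obtain ⟨C, hC⟩ := hcl.bound
    have := hC.self_of_nhds
    simp [hg0] at this
    exact hc this
  -- On this ray the leading term is real and positive, so the real part has the full size r^l,
  -- while the term with q → 0 is o(r^l).
  obtain ⟨u, hu, hcu⟩ := exists_unit_mul_pow_eq (w := 1) hc (by simp) hl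
  have hu0 : u ≠ 0 := by rintro rfl; simp at hu
  have hray := tendsto_ofReal_mul_punctured hu0
  have hray' : Tendsto (fun r : ℝ => (r : ℂ) * u) (𝓝[>] 0) (𝓝 0) := hray.mono_right nhdsWithin_le_nhds
  have hnorm : ∀ k : ℕ, ((fun z : ℂ => ‖z‖ ^ k) ∘ (fun r : ℝ => (r : ℂ) * u)) =O[𝓝[>] 0]
      fun r : ℝ => r ^ k := fun k => isBigO_of_le _ fun r => by simp [hu]
  have hlow : ∀ k, l < k → (fun r : ℝ => r ^ k) =o[𝓝[>] 0] fun r : ℝ => r ^ l := fun k hk =>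
    (isLittleO_pow_pow hk).mono nhdsWithin_le_nhds
  have e1 := ((hcl.comp_tendsto hray').trans (hnorm _)).trans_isLittleO (hlow _ (Nat.lt_succ_self l))
  have e2 : (fun r : ℝ => (g (r * u)).re - ‖c‖ * r ^ l) =o[𝓝[>] 0] fun r : ℝ => r ^ l := by
    refine IsBigO.trans_isLittleO (isBigO_of_le _ fun r => ?_) e1
    have : ((g (r * u)).re - ‖c‖ * r ^ l : ℝ) = (g (r * u) - c * (r * u) ^ l).re := by
      have h1 : c * ((r : ℂ) * u) ^ l = ((‖c‖ * r ^ l : ℝ) : ℂ) := by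
        rw [mul_pow, mul_left_comm, hcu]; push_cast; ring
      rw [h1]; simp only [Complex.sub_re, Complex.ofReal_re]
    rw [this]
    exact Complex.abs_re_le_norm _
  have e3 : (fun r : ℝ => (g (r * u)).im * q (r * u)) =o[𝓝[>] 0] fun r : ℝ => r ^ l := by
    have h1 : (fun r : ℝ => (g (r * u)).im) =O[𝓝[>] 0] fun r : ℝ => r ^ l :=
      (isBigO_of_le _ fun r => Complex.abs_im_le_norm _).trans
        ((hgl.comp_tendsto hray').trans (hnorm l))
    have h2 : (fun r : ℝ => q (r * u)) =o[𝓝[>] 0] fun _ => (1 : ℝ) :=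
      (isLittleO_one_iff ℝ).2 (hq.comp hray)
    simpa using h1.mul_isLittleO h2
  have e4 := ((h.comp_tendsto hray).trans (hnorm n)).trans_isLittleO (hlow n (not_le.1 hln))
  refine not_const_mul_pow_isLittleO (norm_ne_zero_iff.2 hc) (l := l) (le_refl (𝓝[>] (0 : ℝ))) ?_
  have e5 := (e4.sub e3).sub e2
  refine e5.congr_left fun r => ?_
  simp only [Function.comp]
  ring

/-! ### The hypersurface, its test points, and order zero of the invariance equation -/

/-- The defining function `Re z₁ + P(z₂) + Im z₁ · Q(z₂, Im z₁)`. -/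
def graphFunction (P : ℂ → ℝ) (Q : ℂ → ℝ → ℝ) (z : ℂ × ℂ) : ℝ :=
  z.1.re + P z.2 + z.1.im * Q z.2 z.1.im

/-- The germ at the origin of the data defining the hypersurface. -/
structure IsModelGerm (P : ℂ → ℝ) (Q : ℂ → ℝ → ℝ) : Prop extends IsRadialFlat P where
  map_zero₂ : Q 0 0 = 0
  lipschitz : ∃ K, ∀ᶠ x : (ℂ × ℝ) × (ℂ × ℝ) in 𝓝 0,
    ‖Q x.1.1 x.1.2 - Q x.2.1 x.2.2‖ ≤ K * ‖x.1 - x.2‖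
  radial₂ : ∀ᶠ x : ℂ × ℝ in 𝓝 0, Q x.1 x.2 = Q (‖x.1‖ : ℝ) x.2

/-- `(F₁, F₂)` is a holomorphic germ fixing the origin and mapping the hypersurface to itself. -/
structure PreservesGraph (P : ℂ → ℝ) (Q : ℂ → ℝ → ℝ) (F₁ F₂ : ℂ × ℂ → ℂ) : Prop where
  analytic₁ : AnalyticAt ℂ F₁ 0
  analytic₂ : AnalyticAt ℂ F₂ 0
  map_zero₁ : F₁ 0 = 0
  map_zero₂ : F₂ 0 = 0
  maps : ∀ᶠ z in 𝓝 (0 : ℂ × ℂ), graphFunction P Q z = 0 → graphFunction P Q (F₁ z, F₂ z) = 0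

/-- The ratio `z₁ / P(z)` at the point `graphPoint P Q τ z`. -/
noncomputable def graphSlope (P : ℂ → ℝ) (Q : ℂ → ℝ → ℝ) (τ : ℝ) (z : ℂ) : ℂ :=
  -1 + τ * (Complex.I - Q z (τ * P z))

/-- The point of the hypersurface over `z₂ = z` with `Im z₁ = τ P(z)`. -/
noncomputable def graphPoint (P : ℂ → ℝ) (Q : ℂ → ℝ → ℝ) (τ : ℝ) (z : ℂ) : ℂ × ℂ :=
  (P z * graphSlope P Q τ z, z)

namespace IsModelGerm
open Filter Asymptotics

variable {P : ℂ → ℝ} {Q : ℂ → ℝ → ℝ}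

theorem graphPoint_im (τ : ℝ) (z : ℂ) : (graphPoint P Q τ z).1.im = τ * P z := by
  simp [graphPoint, graphSlope]; ring

theorem graphFunction_graphPoint (τ : ℝ) (z : ℂ) : graphFunction P Q (graphPoint P Q τ z) = 0 := by
  rw [graphFunction, graphPoint_im]
  simp [graphPoint, graphSlope]; ring

theorem sub_isBigO₂ {X : Type*} {l : Filter X} (h : IsModelGerm P Q) {a b : X → ℂ} {s t : X → ℝ}
    (ha : Tendsto a l (𝓝 0)) (hb : Tendsto b l (𝓝 0)) (hs : Tendsto s l (𝓝 0))
    (ht : Tendsto t l (𝓝 0)) :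
    (fun x => Q (a x) (s x) - Q (b x) (t x)) =O[l] fun x => ‖a x - b x‖ + ‖s x - t x‖ := by
  obtain ⟨K, hK⟩ := h.lipschitz
  have hlim : Tendsto (fun x => ((a x, s x), (b x, t x))) l (𝓝 0) := by
    have := (ha.prodMk_nhds hs).prodMk_nhds (hb.prodMk_nhds ht)
    exact this
  refine IsBigO.of_bound |K| ?_
  filter_upwards [hlim.eventually hK] with x hx
  refine hx.trans ?_
  refine mul_le_mul (le_abs_self K) ?_ (norm_nonneg _) (abs_nonneg K)
  have h0 : 0 ≤ ‖a x - b x‖ + ‖s x - t x‖ := by positivity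
  rw [Real.norm_of_nonneg h0, Prod.norm_def]
  exact max_le_add_of_nonneg (norm_nonneg _) (norm_nonneg _)

theorem tendsto_zero₂ {X : Type*} {l : Filter X} (h : IsModelGerm P Q) {a : X → ℂ} {s : X → ℝ}
    (ha : Tendsto a l (𝓝 0)) (hs : Tendsto s l (𝓝 0)) :
    Tendsto (fun x => Q (a x) (s x)) l (𝓝 0) := by
  have h1 := h.sub_isBigO₂ ha (tendsto_const_nhds (x := 0)) hs (tendsto_const_nhds (x := 0))
  simp only [h.map_zero₂, sub_zero] at h1
  refine h1.trans_tendsto ?_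
  simpa using ha.norm.add hs.norm

theorem tendsto_zero (h : IsModelGerm P Q) : Tendsto P (𝓝 0) (𝓝 0) := by
  have := h.eventually_differentiableAt.self_of_nhds.continuousAt.tendsto
  rwa [h.map_zero] at this

theorem tendsto_graphSlope (h : IsModelGerm P Q) (τ : ℝ) :
    Tendsto (graphSlope P Q τ) (𝓝 0) (𝓝 (-1 + τ * Complex.I)) := by
  have h1 := h.tendsto_zero₂ tendsto_id
    (show Tendsto (fun z => τ * P z) (𝓝 0) (𝓝 0) by simpa using h.tendsto_zero.const_mul τ)
  have h2 := (((Complex.continuous_ofReal.tendsto 0).comp h1).const_sub Complex.I).const_mul (τ : ℂ)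
  have h3 := h2.const_add (-1)
  simp only [Complex.ofReal_zero, sub_zero] at h3
  exact h3

theorem graphPoint_fst_isBigO (h : IsModelGerm P Q) (τ : ℝ) :
    (fun z => (graphPoint P Q τ z).1) =O[𝓝 0] P := by
  have h1 := (h.tendsto_graphSlope τ).isBigO_one ℝ
  have h2 : (fun z => (P z : ℂ)) =O[𝓝 0] P := isBigO_of_le _ fun z => by simp
  simpa [graphPoint] using h2.mul h1

theorem tendsto_graphPoint (h : IsModelGerm P Q) (τ : ℝ) :
    Tendsto (graphPoint P Q τ) (𝓝 0) (𝓝 0) :=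
  ((h.graphPoint_fst_isBigO τ).trans_tendsto h.tendsto_zero).prodMk_nhds tendsto_id

theorem isBigO_norm (h : IsModelGerm P Q) : P =O[𝓝 0] fun z => ‖z‖ := by
  simpa using h.isBigO_pow 1

theorem graphPoint_isBigO (h : IsModelGerm P Q) (τ : ℝ) :
    (graphPoint P Q τ) =O[𝓝 0] fun z => ‖z‖ :=
  ((h.graphPoint_fst_isBigO τ).trans h.isBigO_norm).prod_left (isBigO_refl (fun z : ℂ => z) _).norm_right

end IsModelGerm

namespace PreservesGraph
open Filter Asymptotics IsModelGerm

variable {P : ℂ → ℝ} {Q : ℂ → ℝ → ℝ} {F₁ F₂ : ℂ × ℂ → ℂ}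

theorem graphPoint_eq (hF : PreservesGraph P Q F₁ F₂) (h : IsModelGerm P Q) (τ : ℝ) :
    ∀ᶠ z in 𝓝 (0 : ℂ), (F₁ (graphPoint P Q τ z)).re + P (F₂ (graphPoint P Q τ z)) +
      (F₁ (graphPoint P Q τ z)).im * Q (F₂ (graphPoint P Q τ z)) (F₁ (graphPoint P Q τ z)).im = 0 :=
  by
  filter_upwards [(h.tendsto_graphPoint τ).eventually hF.maps] with z hz
  exact hz (graphFunction_graphPoint τ z)

theorem tendsto₁ (hF : PreservesGraph P Q F₁ F₂) : Tendsto F₁ (𝓝 0) (𝓝 0) := by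
  have := hF.analytic₁.continuousAt.tendsto; rwa [hF.map_zero₁] at this

theorem tendsto₂ (hF : PreservesGraph P Q F₁ F₂) : Tendsto F₂ (𝓝 0) (𝓝 0) := by
  have := hF.analytic₂.continuousAt.tendsto; rwa [hF.map_zero₂] at this

theorem isBigO₂ (hF : PreservesGraph P Q F₁ F₂) : F₂ =O[𝓝 0] fun z => ‖z‖ := by
  have := hF.analytic₂.differentiableAt.isBigO_sub
  simpa [hF.map_zero₂] using this.norm_right

theorem tendsto_graphPoint₁ (hF : PreservesGraph P Q F₁ F₂) (h : IsModelGerm P Q) (τ : ℝ) :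
    Tendsto (fun z => F₁ (graphPoint P Q τ z)) (𝓝 0) (𝓝 0) :=
  hF.tendsto₁.comp (h.tendsto_graphPoint τ)

theorem tendsto_graphPoint₁_im (hF : PreservesGraph P Q F₁ F₂) (h : IsModelGerm P Q) (τ : ℝ) :
    Tendsto (fun z => (F₁ (graphPoint P Q τ z)).im) (𝓝 0) (𝓝 0) := by
  exact (Complex.continuous_im.tendsto' 0 0 rfl).comp (hF.tendsto_graphPoint₁ h τ)

theorem tendsto_graphPoint₂ (hF : PreservesGraph P Q F₁ F₂) (h : IsModelGerm P Q) (τ : ℝ) :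
    Tendsto (fun z => F₂ (graphPoint P Q τ z)) (𝓝 0) (𝓝 0) :=
  hF.tendsto₂.comp (h.tendsto_graphPoint τ)

theorem graphPoint₂_isBigO (hF : PreservesGraph P Q F₁ F₂) (h : IsModelGerm P Q) (τ : ℝ) :
    (fun z => F₂ (graphPoint P Q τ z)) =O[𝓝 0] fun z => ‖z‖ :=
  (hF.isBigO₂.comp_tendsto (h.tendsto_graphPoint τ)).trans (h.graphPoint_isBigO τ).norm_left

/-- At the test points z₁ = O(P), so the Taylor expansion in z₁ becomes an expansion in powers of
`P`. -/
theorem graphPoint_sub_isBigO (h : IsModelGerm P Q) (τ : ℝ) {F : ℂ × ℂ → ℂ} (n : ℕ)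
    (hF : AnalyticAt ℂ F 0)
    (h0 : ∀ m < n, ∀ᶠ w in 𝓝 (0 : ℂ), partialFst^[m] F (0, w) = 0) :
    (fun z => F (graphPoint P Q τ z) - (P z * graphSlope P Q τ z) ^ n *
      (partialFst^[n] F (0, z) / n.factorial)) =O[𝓝 0] fun z => P z ^ (n + 1) :=
  ((hF.taylor_fst n h0).comp_tendsto (h.tendsto_graphPoint τ)).trans
    ((h.graphPoint_fst_isBigO τ).norm_left.pow (n + 1))

/-- The first component vanishes on `z₁ = 0`. -/
theorem eventually_fst_zero (hF : PreservesGraph P Q F₁ F₂) (h : IsModelGerm P Q) :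
    ∀ᶠ w in 𝓝 (0 : ℂ), F₁ (0, w) = 0 := by
  have hg : AnalyticAt ℂ (fun w : ℂ => F₁ (0, w)) 0 := hF.analytic₁.comp_zero_snd
  refine hg.eventually_eq_zero_of_isBigO_pow fun N => ?_
  -- Take τ = 0. Both F₁ - F₁(0,·) and P∘F₂ are flat at the test points, so invariance leaves only a
  -- real-part condition on F₁(0,·), valid to every order.
  refine hg.isBigO_pow_of_re hF.map_zero₁
    (q := fun z => Q (F₂ (graphPoint P Q 0 z)) (F₁ (graphPoint P Q 0 z)).im)
    ((h.tendsto_zero₂ (hF.tendsto_graphPoint₂ h 0) (hF.tendsto_graphPoint₁_im h 0)).mono_left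
      nhdsWithin_le_nhds) (IsBigO.mono ?_ nhdsWithin_le_nhds)
  have h1 : (fun z => F₁ (graphPoint P Q 0 z) - F₁ (0, z)) =O[𝓝 0] fun z => ‖z‖ ^ N := by
    have := (graphPoint_sub_isBigO h 0 0 hF.analytic₁ (by simp)).trans
      (by simpa using h.isBigO_pow N)
    simpa using this
  have h2 : (fun z => P (F₂ (graphPoint P Q 0 z))) =O[𝓝 0] fun z => ‖z‖ ^ N :=
    ((h.isBigO_pow N).comp_tendsto (hF.tendsto_graphPoint₂ h 0)).trans
      ((hF.graphPoint₂_isBigO h 0).norm_left.pow N)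
  have hq := (h.tendsto_zero₂ (hF.tendsto_graphPoint₂ h 0)
    (hF.tendsto_graphPoint₁_im h 0)).isBigO_one ℝ
  have h3 : (fun z => (F₁ (graphPoint P Q 0 z) - F₁ (0, z)).re) =O[𝓝 0] fun z => ‖z‖ ^ N :=
    (isBigO_of_le _ fun z => Complex.abs_re_le_norm _).trans h1
  have h4 : (fun z => (F₁ (graphPoint P Q 0 z) - F₁ (0, z)).im) =O[𝓝 0] fun z => ‖z‖ ^ N :=
    (isBigO_of_le _ fun z => Complex.abs_im_le_norm _).trans h1
  have h5 := h4.mul hq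
  simp only [mul_one] at h5
  refine (((h2.add h3).add h5).neg_left).congr' ?_ EventuallyEq.rfl
  filter_upwards [hF.graphPoint_eq h 0] with z hz
  simp only [Complex.sub_re, Complex.sub_im]
  linarith

end PreservesGraph

/-! ### Order one of the invariance equation -/

namespace PreservesGraph
open Filter Asymptotics IsModelGerm

variable {P : ℂ → ℝ} {Q : ℂ → ℝ → ℝ} {F₁ F₂ : ℂ × ℂ → ℂ}

theorem sq_isBigO (h : IsModelGerm P Q) (N : ℕ) :
    (fun z => P z ^ 2) =O[𝓝 0] fun z => P z * ‖z‖ ^ N := by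
  simpa [sq] using (isBigO_refl P (𝓝 0)).mul (h.isBigO_pow N)

theorem analyticAt_coeff (hF : PreservesGraph P Q F₁ F₂) :
    AnalyticAt ℂ (fun z : ℂ => partialFst F₁ (0, z)) 0 :=
  hF.analytic₁.partialFst.comp_zero_snd

theorem tendsto_snd_zero (hF : PreservesGraph P Q F₁ F₂) :
    Tendsto (fun z : ℂ => F₂ (0, z)) (𝓝 0) (𝓝 0) := by
  have := hF.analytic₂.comp_zero_snd.continuousAt.tendsto
  rwa [show F₂ (0, (0 : ℂ)) = 0 from hF.map_zero₂] at this

theorem snd_zero_isBigO (hF : PreservesGraph P Q F₁ F₂) :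
    (fun z : ℂ => F₂ (0, z)) =O[𝓝 0] fun z => ‖z‖ := by
  have h0 : F₂ (0, (0 : ℂ)) = 0 := hF.map_zero₂
  have := hF.analytic₂.comp_zero_snd.differentiableAt.isBigO_sub
  simpa [h0] using this.norm_right

/-- The first order part in `P` of the invariance equation. -/
theorem first_order_eq (hF : PreservesGraph P Q F₁ F₂) (h : IsModelGerm P Q) (τ : ℝ) (N : ℕ) :
    (fun z => P z * (((-1 + τ * (Complex.I - Q z 0)) * partialFst F₁ (0, z)).re +
        ((-1 + τ * (Complex.I - Q z 0)) * partialFst F₁ (0, z)).im * Q (F₂ (0, z)) 0) +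
        P (F₂ (0, z))) =O[𝓝 0] fun z => P z * ‖z‖ ^ N := by
  set ζ₀ : ℂ → ℂ := fun z => -1 + τ * (Complex.I - Q z 0) with hζ₀
  set H : ℂ → ℂ := fun z => partialFst F₁ (0, z) with hH
  have hHb : H =O[𝓝 0] fun _ => (1 : ℝ) := hF.analyticAt_coeff.continuousAt.isBigO_one ℝ
  have hPP : (fun z => (P z : ℂ)) =O[𝓝 0] P := isBigO_of_le _ fun z => by simp
  have hτP : Tendsto (fun z => τ * P z) (𝓝 0) (𝓝 0) := by simpa using h.tendsto_zero.const_mul τ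
  have d2 : (fun z => graphSlope P Q τ z - ζ₀ z) =O[𝓝 0] P := by
    have h1 := h.sub_isBigO₂ (a := fun z => z) (b := fun z => z) (s := fun _ => 0) tendsto_id
      tendsto_id tendsto_const_nhds hτP
    have h2 : (fun z => Q z 0 - Q z (τ * P z)) =O[𝓝 0] P := by
      refine h1.trans (IsBigO.of_bound |τ| (Eventually.of_forall fun z => ?_))
      simp
    have h3 : (fun z => τ * (Q z 0 - Q z (τ * P z))) =O[𝓝 0] P := h2.const_mul_left τ
    refine IsBigO.congr_left ((isBigO_of_le _ fun z => ?_).trans h3) (f₁ := fun z =>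
      ((τ * (Q z 0 - Q z (τ * P z)) : ℝ) : ℂ)) fun z => ?_
    · exact (Complex.norm_real _).le
    · simp only [graphSlope, hζ₀]; push_cast; ring
  have hζb : ζ₀ =O[𝓝 0] fun _ => (1 : ℝ) := by
    have h1 : (graphSlope P Q τ) =O[𝓝 0] fun _ => (1 : ℝ) := (h.tendsto_graphSlope τ).isBigO_one ℝ
    simpa using h1.sub (d2.trans (h.tendsto_zero.isBigO_one ℝ))
  have d3 : (fun z => F₁ (graphPoint P Q τ z) - P z * ζ₀ z * H z) =O[𝓝 0] fun z => P z ^ 2 := by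
    have d1 := graphPoint_sub_isBigO h τ 1 hF.analytic₁
      (fun m hm => by
        obtain rfl : m = 0 := by omega
        simpa using hF.eventually_fst_zero h)
    have d1' := ((hPP.mul d2).mul hHb)
    refine ((d1.add (d1'.congr_right fun z => by ring)).congr_left fun z => ?_)
    simp [hH]; ring
  have hF1 : (fun z => F₁ (graphPoint P Q τ z)) =O[𝓝 0] P := by
    have h1 := ((hPP.mul hζb).mul hHb)
    have h2 : (fun z => P z ^ 2) =O[𝓝 0] P := by simpa using sq_isBigO h 0
    simpa using (d3.trans h2).add (h1.congr_right fun z => by ring)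
  have d4 : (fun z => F₂ (graphPoint P Q τ z) - F₂ (0, z)) =O[𝓝 0] P := by
    simpa using graphPoint_sub_isBigO h τ 0 hF.analytic₂ (by simp)
  -- The argument of `P` moves by O(P) and the gradient of `P` is flat, so restricting F₂ to z₁ = 0
  -- costs `P` times any power of ‖z‖.
  have d5 : (fun z => P (F₂ (graphPoint P Q τ z)) - P (F₂ (0, z))) =O[𝓝 0]
      fun z => P z * ‖z‖ ^ N := by
    have h1 := h.sub_isBigO (hF.graphPoint₂_isBigO h τ) hF.snd_zero_isBigO tendsto_norm_zero N
    refine h1.trans ?_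
    refine ((isBigO_refl (fun z : ℂ => ‖z‖ ^ N) (𝓝 0)).mul d4.norm_left).congr_right fun z => ?_
    ring
  have him : (fun z => (F₁ (graphPoint P Q τ z)).im) =O[𝓝 0] P :=
    (isBigO_of_le _ fun z => Complex.abs_im_le_norm _).trans hF1
  have d6 : (fun z => Q (F₂ (0, z)) 0 - Q (F₂ (graphPoint P Q τ z)) (F₁ (graphPoint P Q τ z)).im)
      =O[𝓝 0] P := by
    have h1 := h.sub_isBigO₂ hF.tendsto_snd_zero (hF.tendsto_graphPoint₂ h τ)
      (tendsto_const_nhds (x := 0)) (hF.tendsto_graphPoint₁_im h τ)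
    refine h1.trans (IsBigO.add ?_ ?_)
    · exact (d4.neg_left.congr_left fun z => by ring).norm_left
    · simpa using him
  have d7 : (fun z => (P z * ζ₀ z * H z - F₁ (graphPoint P Q τ z)).im * Q (F₂ (0, z)) 0) =O[𝓝 0]
      fun z => P z ^ 2 := by
    have h1 : (fun z => (P z * ζ₀ z * H z - F₁ (graphPoint P Q τ z)).im) =O[𝓝 0]
        fun z => P z ^ 2 :=
      (isBigO_of_le _ fun z => Complex.abs_im_le_norm _).trans
        (d3.neg_left.congr_left fun z => by ring)
    have h2 := (h.tendsto_zero₂ hF.tendsto_snd_zero (tendsto_const_nhds (x := 0))).isBigO_one ℝ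
    simpa using h1.mul h2
  have d8 := (him.mul d6).congr_right fun z => (sq (P z)).symm
  have d9 : (fun z => (P z * ζ₀ z * H z - F₁ (graphPoint P Q τ z)).re) =O[𝓝 0]
      fun z => P z ^ 2 :=
    (isBigO_of_le _ fun z => Complex.abs_re_le_norm _).trans
      (d3.neg_left.congr_left fun z => by ring)
  refine ((((d9.add d7).add d8).trans (sq_isBigO h N)).sub d5).congr' ?_ EventuallyEq.rfl
  filter_upwards [hF.graphPoint_eq h τ] with z hz
  have e1 : P z * (ζ₀ z * H z).re = (P z * ζ₀ z * H z).re := by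
    rw [mul_assoc, Complex.re_ofReal_mul]
  have e2 : P z * (ζ₀ z * H z).im = (P z * ζ₀ z * H z).im := by
    rw [mul_assoc, Complex.im_ofReal_mul]
  change _ = P z * ((ζ₀ z * H z).re + (ζ₀ z * H z).im * Q (F₂ (0, z)) 0) + P (F₂ (0, z))
  rw [mul_add (P z), ← mul_assoc (P z), e1, e2]
  simp only [Complex.sub_re, Complex.sub_im]
  linear_combination (-1 : ℝ) * hz

/-- Division of `first_order_eq` by `P`, off the origin. -/
theorem first_order_div (hF : PreservesGraph P Q F₁ F₂) (h : IsModelGerm P Q) (τ : ℝ) (N : ℕ) :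
    (fun z => ((-1 + τ * (Complex.I - Q z 0)) * partialFst F₁ (0, z)).re +
        ((-1 + τ * (Complex.I - Q z 0)) * partialFst F₁ (0, z)).im * Q (F₂ (0, z)) 0 +
        P (F₂ (0, z)) / P z) =O[𝓝[≠] 0] fun z => ‖z‖ ^ N := by
  have h1 := ((hF.first_order_eq h τ N).mono (nhdsWithin_le_nhds (s := {0}ᶜ))).mul
    (isBigO_refl (fun z => (P z)⁻¹) _)
  have hpos : ∀ᶠ z in 𝓝[≠] (0 : ℂ), 0 < P z := by
    filter_upwards [h.pos.filter_mono nhdsWithin_le_nhds, self_mem_nhdsWithin] with z hz hz0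
      using hz hz0
  refine h1.congr' ?_ ?_
  · filter_upwards [hpos] with z hz
    field_simp
  · filter_upwards [hpos] with z hz
    field_simp

/-- The imaginary part of the coefficient of `z₁`. -/
theorem im_coeff_isBigO (hF : PreservesGraph P Q F₁ F₂) (h : IsModelGerm P Q) (N : ℕ) :
    (fun z => (partialFst F₁ (0, z)).im * (1 + Q z 0 * Q (F₂ (0, z)) 0) -
      (partialFst F₁ (0, z)).re * (Q (F₂ (0, z)) 0 - Q z 0)) =O[𝓝[≠] 0] fun z => ‖z‖ ^ N := by
  -- The quotient P∘φ/P does not depend on τ, so it cancels between τ = 0 and τ = 1.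
  refine ((hF.first_order_div h 0 N).sub (hF.first_order_div h 1 N)).congr_left fun z => ?_
  simp
  ring

theorem ratio_sub_isBigO (hF : PreservesGraph P Q F₁ F₂) (h : IsModelGerm P Q) (N : ℕ) :
    (fun z => P (F₂ (0, z)) / P z - ((partialFst F₁ (0, z)).re +
      (partialFst F₁ (0, z)).im * Q (F₂ (0, z)) 0)) =O[𝓝[≠] 0] fun z => ‖z‖ ^ N := by
  refine (hF.first_order_div h 0 N).congr_left fun z => ?_
  simp
  ring

theorem tendsto_re_coeff (hF : PreservesGraph P Q F₁ F₂) :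
    Tendsto (fun z : ℂ => (partialFst F₁ (0, z)).re) (𝓝[≠] 0) (𝓝 (partialFst F₁ 0).re) :=
  ((Complex.continuous_re.tendsto _).comp hF.analyticAt_coeff.continuousAt.tendsto).mono_left
    nhdsWithin_le_nhds

theorem tendsto_im_coeff (hF : PreservesGraph P Q F₁ F₂) :
    Tendsto (fun z : ℂ => (partialFst F₁ (0, z)).im) (𝓝[≠] 0) (𝓝 (partialFst F₁ 0).im) :=
  ((Complex.continuous_im.tendsto _).comp hF.analyticAt_coeff.continuousAt.tendsto).mono_left
    nhdsWithin_le_nhds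

theorem tendsto_Q (h : IsModelGerm P Q) : Tendsto (fun z => Q z 0) (𝓝[≠] 0) (𝓝 0) :=
  (h.tendsto_zero₂ tendsto_id (tendsto_const_nhds (x := 0))).mono_left nhdsWithin_le_nhds

theorem tendsto_Q_snd (hF : PreservesGraph P Q F₁ F₂) (h : IsModelGerm P Q) :
    Tendsto (fun z => Q (F₂ (0, z)) 0) (𝓝[≠] 0) (𝓝 0) :=
  (h.tendsto_zero₂ hF.tendsto_snd_zero (tendsto_const_nhds (x := 0))).mono_left nhdsWithin_le_nhds

theorem tendsto_norm_punctured : Tendsto (fun z : ℂ => ‖z‖) (𝓝[≠] 0) (𝓝 0) :=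
  tendsto_norm_zero.mono_left nhdsWithin_le_nhds

theorem im_coeff_zero (hF : PreservesGraph P Q F₁ F₂) (h : IsModelGerm P Q) :
    (partialFst F₁ 0).im = 0 := by
  have h1 := (hF.im_coeff_isBigO h 1).trans_tendsto (by simpa using tendsto_norm_punctured)
  have h2 := (hF.tendsto_im_coeff.mul (((tendsto_Q h).mul (hF.tendsto_Q_snd h)).const_add 1)).sub
    (hF.tendsto_re_coeff.mul ((hF.tendsto_Q_snd h).sub (tendsto_Q h)))
  simpa using tendsto_nhds_unique h2 h1

theorem tendsto_ratio (hF : PreservesGraph P Q F₁ F₂) (h : IsModelGerm P Q) :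
    Tendsto (fun z => P (F₂ (0, z)) / P z) (𝓝[≠] 0) (𝓝 (partialFst F₁ 0).re) := by
  have h1 := (hF.ratio_sub_isBigO h 1).trans_tendsto (by simpa using tendsto_norm_punctured)
  have h2 := hF.tendsto_re_coeff.add (hF.tendsto_im_coeff.mul (hF.tendsto_Q_snd h))
  simpa using h1.add h2

/-- The real part is the limit of the nonnegative quotients P∘φ/P, and the imaginary part vanishes
at 0. -/
theorem re_coeff_pos (hF : PreservesGraph P Q F₁ F₂) (h : IsModelGerm P Q)
    (h0 : partialFst F₁ 0 ≠ 0) : 0 < (partialFst F₁ 0).re := by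
  have h1 : 0 ≤ (partialFst F₁ 0).re := by
    refine ge_of_tendsto (hF.tendsto_ratio h) ?_
    have hnn : ∀ᶠ w in 𝓝 (0 : ℂ), 0 ≤ P w := by
      filter_upwards [h.pos] with w hw
      rcases eq_or_ne w 0 with rfl | hw0
      · exact h.map_zero.ge
      · exact (hw hw0).le
    filter_upwards [hnn.filter_mono nhdsWithin_le_nhds,
      (hF.tendsto_snd_zero.eventually hnn).filter_mono nhdsWithin_le_nhds] with z hz hz'
    exact div_nonneg hz' hz
  refine lt_of_le_of_ne h1 fun h2 => h0 ?_
  exact Complex.ext h2.symm (hF.im_coeff_zero h)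

end PreservesGraph

/-! ### Maps φ for which P∘φ/P has a positive limit -/

open Filter Asymptotics in
theorem tendsto_ofReal_punctured : Tendsto (fun r : ℝ => (r : ℂ)) (𝓝[>] 0) (𝓝[≠] 0) := by
  simpa using tendsto_ofReal_mul_punctured (u := 1) one_ne_zero

namespace IsRadialFlat
open Filter Asymptotics

variable {P : ℂ → ℝ}

theorem eventually_pos (hP : IsRadialFlat P) : ∀ᶠ z in 𝓝[≠] (0 : ℂ), 0 < P z := by
  filter_upwards [hP.pos.filter_mono nhdsWithin_le_nhds, self_mem_nhdsWithin] with z hz hz0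
    using hz hz0

/-- A contraction would lose only a bounded factor of `P` while r^(-N) gains c^(-N). Once c^N < a/2,
passing from r to |φ(r)| is a forbidden descent. -/
theorem not_contracting (hP : IsRadialFlat P) {φ : ℂ → ℂ} {a c : ℝ} (ha : 0 < a)
    (hc : c < 1) (hφ : Tendsto φ (𝓝 0) (𝓝 0)) (hle : ∀ᶠ z in 𝓝[≠] 0, ‖φ z‖ ≤ c * ‖z‖)
    (hE : Tendsto (fun z => P (φ z) / P z) (𝓝[≠] 0) (𝓝 a)) : False := by
  obtain ⟨N, hN⟩ := exists_pow_lt_of_lt_one (half_pos ha) hc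
  refine hP.not_exists_weighted_descent (w := fun r => (r ^ N)⁻¹)
    ((continuousOn_pow N).inv₀ fun r hr => pow_ne_zero _ (ne_of_gt hr))
    (fun r hr => by positivity) (hP.tendsto_div_pow N) ?_
  filter_upwards [tendsto_ofReal_punctured.eventually hle,
    tendsto_ofReal_punctured.eventually (hE.eventually_const_lt (half_lt_self ha)),
    tendsto_ofReal_punctured.eventually hP.eventually_pos,
    tendsto_ofReal_punctured.eventually ((hφ.eventually hP.radial).filter_mono nhdsWithin_le_nhds),
    self_mem_nhdsWithin] with r h1 h2 h3 h4 hr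
  have hr0 : (0 : ℝ) < r := hr
  rw [Complex.norm_of_nonneg hr0.le] at h1
  rw [lt_div_iff₀ h3] at h2
  have hPφ : 0 < P (φ r) := lt_trans (by positivity) h2
  have hs : 0 < ‖φ r‖ := norm_pos_iff.2 fun h0 => by
    rw [h0, hP.map_zero] at hPφ; exact lt_irrefl _ hPφ
  refine ⟨‖φ r‖, hs, by nlinarith, ?_⟩
  rw [← h4, ← div_eq_mul_inv, ← div_eq_mul_inv, div_le_div_iff₀ (by positivity) (by positivity)]
  have h5 : ‖φ r‖ ^ N ≤ a / 2 * r ^ N := by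
    calc ‖φ r‖ ^ N ≤ (c * r) ^ N := by gcongr
      _ = c ^ N * r ^ N := mul_pow _ _ _
      _ ≤ a / 2 * r ^ N := by gcongr
  calc P r * ‖φ r‖ ^ N ≤ P r * (a / 2 * r ^ N) := by gcongr
    _ = a / 2 * P r * r ^ N := by ring
    _ ≤ P (φ r) * r ^ N := by gcongr

/-- The contraction argument run backwards: continuity yields a smaller radius s with |φ(s)| = r,
which replaces the inverse of φ, and the descent goes from r to s. -/
theorem not_expanding (hP : IsRadialFlat P) {φ : ℂ → ℂ} {a c : ℝ} (ha : 0 < a)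
    (hc : 1 < c) (hφ : AnalyticAt ℂ φ 0) (hφ0 : φ 0 = 0)
    (hle : ∀ᶠ z in 𝓝[≠] 0, c * ‖z‖ ≤ ‖φ z‖)
    (hE : Tendsto (fun z => P (φ z) / P z) (𝓝[≠] 0) (𝓝 a)) : False := by
  obtain ⟨N, hN⟩ := pow_unbounded_of_one_lt (2 * a) hc
  refine hP.not_exists_weighted_descent (w := fun r => (r ^ N)⁻¹)
    ((continuousOn_pow N).inv₀ fun r hr => pow_ne_zero _ (ne_of_gt hr))
    (fun r hr => by positivity) (hP.tendsto_div_pow N) ?_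
  have hφt : Tendsto φ (𝓝 0) (𝓝 0) := by simpa [hφ0] using hφ.continuousAt.tendsto
  have hcont : ∀ᶠ z in 𝓝[≠] 0, ContinuousAt φ z :=
    (hφ.eventually_analyticAt.mono fun z hz => hz.continuousAt).filter_mono nhdsWithin_le_nhds
  have hall := (((hle.and (hE.eventually_lt_const (by linarith : a < 2 * a))).and
    (hP.eventually_pos.and ((hφt.eventually hP.radial).filter_mono nhdsWithin_le_nhds))).and hcont)
  obtain ⟨r₀, hr₀, hsub⟩ := mem_nhdsGT_iff_exists_Ioc_subset.1
    (tendsto_ofReal_punctured.eventually hall)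
  filter_upwards [Ioc_mem_nhdsGT hr₀] with r hr
  have hr0 : 0 < r := hr.1
  have hcon : ContinuousOn (fun s : ℝ => ‖φ s‖) (Set.Icc 0 r) := by
    intro s hs
    have : ContinuousAt φ (s : ℂ) := by
      rcases hs.1.eq_or_lt with h0 | h0
      · rw [← h0]; simpa using hφ.continuousAt
      · exact (hsub ⟨h0, hs.2.trans hr.2⟩).2
    exact (ContinuousAt.comp (f := fun s : ℝ => (s : ℂ)) this
      Complex.continuous_ofReal.continuousAt).norm.continuousWithinAt
  have hφr := (hsub hr).1.1.1
  rw [Complex.norm_of_nonneg hr0.le] at hφr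
  obtain ⟨s, hs, hsr⟩ := intermediate_value_Icc hr0.le hcon
    (show r ∈ Set.Icc ‖φ (0 : ℝ)‖ ‖φ r‖ from ⟨by simp [hφ0, hr0.le], by nlinarith⟩)
  have hsr' : ‖φ s‖ = r := hsr
  have hs0 : 0 < s := by
    rcases hs.1.eq_or_lt with h0 | h0
    · rw [← h0] at hsr'; simp [hφ0] at hsr'; linarith
    · exact h0
  obtain ⟨⟨⟨h1, h2⟩, h3, h4⟩, -⟩ := hsub (⟨hs0, hs.2.trans hr.2⟩ : s ∈ Set.Ioc 0 r₀)
  rw [Complex.norm_of_nonneg hs0.le, hsr'] at h1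
  rw [hsr'] at h4
  rw [h4, div_lt_iff₀ h3] at h2
  refine ⟨s, hs0, by nlinarith, ?_⟩
  rw [← div_eq_mul_inv, ← div_eq_mul_inv, div_le_div_iff₀ (by positivity) (by positivity)]
  have h5 : 2 * a * s ^ N ≤ r ^ N := by
    calc 2 * a * s ^ N ≤ c ^ N * s ^ N := by gcongr
      _ = (c * s) ^ N := (mul_pow _ _ _).symm
      _ ≤ r ^ N := by gcongr
  calc P r * s ^ N ≤ 2 * a * P s * s ^ N := by gcongr
    _ = P s * (2 * a * s ^ N) := by ring
    _ ≤ P s * r ^ N := by gcongr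

theorem norm_deriv_eq_one (hP : IsRadialFlat P) {φ : ℂ → ℂ} {a : ℝ} (ha : 0 < a)
    (hφ : AnalyticAt ℂ φ 0) (hφ0 : φ 0 = 0)
    (hE : Tendsto (fun z => P (φ z) / P z) (𝓝[≠] 0) (𝓝 a)) : ‖deriv φ 0‖ = 1 := by
  have hφt : Tendsto φ (𝓝 0) (𝓝 0) := by simpa [hφ0] using hφ.continuousAt.tendsto
  have hslope : Tendsto (fun z => ‖φ z‖ / ‖z‖) (𝓝[≠] 0) (𝓝 ‖deriv φ 0‖) := by
    have := (hasDerivAt_iff_tendsto_slope.1 hφ.differentiableAt.hasDerivAt).norm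
    refine this.congr fun z => ?_
    simp [slope, hφ0, div_eq_inv_mul]
  rcases lt_trichotomy ‖deriv φ 0‖ 1 with h | h | h
  · exfalso
    obtain ⟨c, hc, hc1⟩ := exists_between h
    refine hP.not_contracting ha hc1 hφt ?_ hE
    filter_upwards [hslope.eventually_lt_const hc, self_mem_nhdsWithin] with z hz hz0
    exact ((div_lt_iff₀ (norm_pos_iff.2 hz0)).1 hz).le
  · exact h
  · exfalso
    obtain ⟨c, hc1, hc⟩ := exists_between h
    refine hP.not_expanding ha hc1 hφ hφ0 ?_ hE
    filter_upwards [hslope.eventually_const_lt hc, self_mem_nhdsWithin] with z hz hz0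
    exact ((lt_div_iff₀ (norm_pos_iff.2 hz0)).1 hz).le

/-- Along a suitable ray a map tangent to the identity moves points outwards or inwards. -/
theorem exists_ray_norm_bound {φ : ℂ → ℂ} {c : ℂ} {m : ℕ} (hc : c ≠ 0) (hm : 2 ≤ m)
    (hd : (fun z => φ z - z - c * z ^ m) =O[𝓝 0] fun z => ‖z‖ ^ (m + 1)) {σ : ℝ} (hσ : |σ| = 1) :
    ∃ u : ℂ, ‖u‖ = 1 ∧ ∀ᶠ r : ℝ in 𝓝[>] 0,
      |‖φ (r * u)‖ - (r + σ * ‖c‖ * r ^ m)| ≤ ‖c‖ / 2 * r ^ m := by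
  -- The exponent is m - 1 because c(ru)^m = σ‖c‖r^m · u is then a displacement along the ray
  -- itself.
  obtain ⟨u, hu, hcu⟩ := exists_unit_mul_pow_eq (w := (σ : ℂ)) hc (by simpa using hσ)
    (show m - 1 ≠ 0 by omega)
  have hu0 : u ≠ 0 := by rintro rfl; simp at hu
  refine ⟨u, hu, ?_⟩
  have hray := (tendsto_ofReal_mul_punctured hu0).mono_right nhdsWithin_le_nhds
  obtain ⟨C, hC0, hC⟩ := hd.exists_pos
  have hsmall : ∀ᶠ r : ℝ in 𝓝[>] 0, C * r ≤ ‖c‖ / 2 ∧ ‖c‖ * r ≤ 1 ∧ r ≤ 1 := by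
    have ht : ∀ K : ℝ, Tendsto (fun r : ℝ => K * r) (𝓝[>] 0) (𝓝 0) := fun K =>
      ((continuous_const.mul continuous_id).tendsto' 0 0 (by simp)).mono_left nhdsWithin_le_nhds
    have hcpos : 0 < ‖c‖ / 2 := by positivity
    filter_upwards [(ht C).eventually_lt_const hcpos, (ht ‖c‖).eventually_lt_const one_pos,
      (ht 1).eventually_lt_const one_pos] with r h1 h2 h3
    exact ⟨h1.le, h2.le, by linarith⟩
  filter_upwards [hray.eventually hC.bound, hsmall, self_mem_nhdsWithin] with r h1 h2 hr
  have hr0 : (0 : ℝ) < r := hr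
  have hcum : c * ((r : ℂ) * u) ^ m = ((σ * ‖c‖ * r ^ m : ℝ) : ℂ) * u := by
    obtain ⟨k, rfl⟩ : ∃ k, m = k + 1 := ⟨m - 1, by omega⟩
    simp only [Nat.add_sub_cancel] at hcu
    rw [mul_pow, pow_succ u, mul_left_comm, ← mul_assoc c, hcu]
    push_cast; ring
  have hpos : 0 ≤ r + σ * ‖c‖ * r ^ m := by
    have h3 : ‖c‖ * r ^ m ≤ r := by
      obtain ⟨k, rfl⟩ : ∃ k, m = k + 2 := ⟨m - 2, by omega⟩
      have h4 : r ^ k ≤ 1 := pow_le_one₀ hr0.le h2.2.2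
      calc ‖c‖ * r ^ (k + 2) = (‖c‖ * r) * r * r ^ k := by ring
        _ ≤ 1 * r * 1 := by gcongr; exact h2.2.1
        _ = r := by ring
    have h5 : -1 ≤ σ := (abs_le.1 hσ.le).1
    have h6 : 0 ≤ ‖c‖ * r ^ m := by positivity
    nlinarith
  have hnorm : ‖((r + σ * ‖c‖ * r ^ m : ℝ) : ℂ) * u‖ = r + σ * ‖c‖ * r ^ m := by
    rw [norm_mul, hu, mul_one, Complex.norm_of_nonneg hpos]
  rw [← hnorm]
  refine (abs_norm_sub_norm_le _ _).trans ?_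
  have heq : φ (r * u) - ((r + σ * ‖c‖ * r ^ m : ℝ) : ℂ) * u
      = φ (r * u) - r * u - c * ((r : ℂ) * u) ^ m := by
    rw [hcum]; push_cast; ring
  rw [heq]
  refine h1.trans ?_
  rw [norm_pow, norm_norm, norm_mul, hu, mul_one, Complex.norm_of_nonneg hr0.le, pow_succ]
  calc C * (r ^ m * r) = C * r * r ^ m := by ring
    _ ≤ ‖c‖ / 2 * r ^ m := by gcongr; exact h2.1

/-- The ratio `P ∘ φ / P` cannot be constant up to the order of contact of `φ` with the identity. -/
theorem not_ratio_isBigO (hP : IsRadialFlat P) {φ : ℂ → ℂ} {a : ℝ} {c : ℂ} {m : ℕ}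
    (hφ : AnalyticAt ℂ φ 0) (hφ0 : φ 0 = 0) (hc : c ≠ 0) (hm : 2 ≤ m)
    (hd : (fun z => φ z - z - c * z ^ m) =O[𝓝 0] fun z => ‖z‖ ^ (m + 1))
    (hE : (fun z => P (φ z) / P z - a) =O[𝓝[≠] 0] fun z => ‖z‖ ^ m) : False := by
  have hφt : Tendsto φ (𝓝 0) (𝓝 0) := by simpa [hφ0] using hφ.continuousAt.tendsto
  have hEt : Tendsto (fun z => P (φ z) / P z) (𝓝[≠] 0) (𝓝 a) := by
    have h1 : Tendsto (fun z : ℂ => ‖z‖ ^ m) (𝓝[≠] 0) (𝓝 0) :=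
      ((continuous_norm.pow m).tendsto' 0 0 (by simp; omega)).mono_left nhdsWithin_le_nhds
    simpa using (hE.trans_tendsto h1).add_const a
  have hcp : 0 < ‖c‖ := norm_pos_iff.2 hc
  obtain ⟨u, hu, hur⟩ := exists_ray_norm_bound hc hm hd (σ := -1) (by simp)
  obtain ⟨v, hv, hvr⟩ := exists_ray_norm_bound hc hm hd (σ := 1) (by simp)
  have hu0 : u ≠ 0 := by rintro rfl; simp at hu
  -- On every small circle some point keeps its modulus.
  have ha : a = 1 := by
    by_contra hne
    have h1 : ∀ᶠ z in 𝓝[≠] (0 : ℂ), P (φ z) / P z ≠ 1 ∧ 0 < P z ∧ P (φ z) = P (‖φ z‖ : ℝ) ∧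
        P z = P (‖z‖ : ℝ) ∧ ContinuousAt φ z :=
      (hEt.eventually_ne hne).and (hP.eventually_pos.and
        (((hφt.eventually hP.radial).and (hP.radial.and (hφ.eventually_analyticAt.mono
          fun z hz => hz.continuousAt))).filter_mono nhdsWithin_le_nhds))
    obtain ⟨ε, hε, hball⟩ := Metric.mem_nhdsWithin_iff.1 h1
    obtain ⟨r, ⟨⟨h2, h3⟩, h4⟩⟩ := ((hur.and hvr).and (Ioo_mem_nhdsGT hε)).exists
    have hr0 : 0 < r := h4.1
    have hin : ∀ z ∈ Metric.sphere (0 : ℂ) r, z ∈ Metric.ball (0 : ℂ) ε ∩ {0}ᶜ := by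
      intro z hz
      have hz' : ‖z‖ = r := by simpa using hz
      refine ⟨by simpa [hz'] using h4.2, fun h0 => ?_⟩
      rw [Set.mem_singleton_iff] at h0
      rw [h0, norm_zero] at hz'; linarith
    have hcon : ContinuousOn (fun z => ‖φ z‖) (Metric.sphere (0 : ℂ) r) := fun z hz =>
      (hball (hin z hz)).2.2.2.2.norm.continuousWithinAt
    have hpre : IsPreconnected (Metric.sphere (0 : ℂ) r) :=
      isPreconnected_sphere (by simp [Complex.rank_real_complex]) 0 r
    have hcr : 0 < ‖c‖ * r ^ m := by positivity
    obtain ⟨z, hz, hzr⟩ := hpre.intermediate_value (a := r * u) (b := r * v)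
      (by simp [hu, hr0.le]) (by simp [hv, hr0.le]) hcon
      (show r ∈ Set.Icc ‖φ (r * u)‖ ‖φ (r * v)‖ from
        ⟨by linarith [(abs_le.1 h2).2], by linarith [(abs_le.1 h3).1]⟩)
    have hz' : ‖z‖ = r := by simpa using hz
    obtain ⟨h5, h6, h7, h8, -⟩ := hball (hin z hz)
    simp only at hzr
    rw [hzr, ← hz', ← h8] at h7
    exact h5 (by rw [h7, div_self h6.ne'])
  subst ha
  obtain ⟨C, hC0, hC⟩ := hE.exists_pos
  -- Along the inward ray φ lowers the radius by at least ‖c‖r^m/2, so this weight gains a factor of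
  -- at least 1 + 2Cr^m. This outweighs the loss 1 - Cr^m in `P` as soon as Cr^m ≤ 1/2.
  refine hP.not_exists_weighted_descent (w := fun r => Real.exp (-(4 * C / ‖c‖) * r))
    (by fun_prop) (fun r _ => Real.exp_pos _) ?_ ?_
  · have h1 : Tendsto (fun r : ℝ => P r) (𝓝[>] 0) (𝓝 0) := by
      simpa using hP.tendsto_div_pow 0
    have h2 : Tendsto (fun r : ℝ => Real.exp (-(4 * C / ‖c‖) * r)) (𝓝[>] 0) (𝓝 1) :=
      (Continuous.tendsto' (by fun_prop) 0 1 (by simp)).mono_left nhdsWithin_le_nhds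
    simpa using h1.mul h2
  · have hray := tendsto_ofReal_mul_punctured hu0
    have hrm : Tendsto (fun r : ℝ => C * r ^ m) (𝓝[>] 0) (𝓝 0) :=
      (Continuous.tendsto' (by fun_prop) 0 0 (by simp; omega)).mono_left nhdsWithin_le_nhds
    filter_upwards [hur, hray.eventually hC.bound, hray.eventually hP.eventually_pos,
      hray.eventually ((hφt.eventually hP.radial).filter_mono nhdsWithin_le_nhds),
      (hray.mono_right nhdsWithin_le_nhds).eventually hP.radial,
      hrm.eventually_lt_const (by norm_num : (0 : ℝ) < 1 / 2), self_mem_nhdsWithin]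
      with r h1 h2 h3 h4 h5 h6 hr
    have hr0 : (0 : ℝ) < r := hr
    have hnr : ‖(r : ℂ) * u‖ = r := by rw [norm_mul, hu, mul_one, Complex.norm_of_nonneg hr0.le]
    rw [hnr] at h2 h5
    have hcr : 0 < ‖c‖ * r ^ m := by positivity
    have hs : ‖φ (r * u)‖ ≤ r - ‖c‖ / 2 * r ^ m := by linarith [(abs_le.1 h1).2]
    have hx : 0 < C * r ^ m := by positivity
    have h7 : (1 - C * r ^ m) * P r ≤ P (φ (r * u)) := by
      have := (abs_le.1 (show |P (φ (r * u)) / P (r * u) - 1| ≤ _ from h2)).1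
      rw [norm_pow, Real.norm_of_nonneg hr0.le] at this
      rw [← h5, ← le_div_iff₀ h3]
      linarith
    rw [h5] at h3
    have hPφ : 0 < P (φ (r * u)) := lt_of_lt_of_le (mul_pos (by linarith) h3) h7
    have hs0 : 0 < ‖φ (r * u)‖ := norm_pos_iff.2 fun h0 => by
      rw [h0, hP.map_zero] at hPφ; exact lt_irrefl _ hPφ
    refine ⟨‖φ (r * u)‖, hs0, by linarith, ?_⟩
    rw [← h4]
    set A := 4 * C / ‖c‖ with hA
    have hA0 : 0 < A := by positivity
    have h8 : Real.exp (-A * r) * (1 + 2 * (C * r ^ m)) ≤ Real.exp (-A * ‖φ (r * u)‖) := by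
      have h9 : 1 + 2 * (C * r ^ m) ≤ Real.exp (A * (r - ‖φ (r * u)‖)) := by
        have h10 : 2 * (C * r ^ m) ≤ A * (r - ‖φ (r * u)‖) := by
          calc 2 * (C * r ^ m) = A * (‖c‖ / 2 * r ^ m) := by rw [hA]; field_simp; ring
            _ ≤ A * (r - ‖φ (r * u)‖) := by gcongr; linarith
        linarith [Real.add_one_le_exp (A * (r - ‖φ (r * u)‖))]
      calc Real.exp (-A * r) * (1 + 2 * (C * r ^ m))
          ≤ Real.exp (-A * r) * Real.exp (A * (r - ‖φ (r * u)‖)) := by gcongr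
        _ = Real.exp (-A * ‖φ (r * u)‖) := by rw [← Real.exp_add]; ring_nf
    calc P r * Real.exp (-A * r)
        ≤ P r * Real.exp (-A * r) * ((1 - C * r ^ m) * (1 + 2 * (C * r ^ m))) := by
          refine le_mul_of_one_le_right (by positivity) ?_
          nlinarith
      _ = ((1 - C * r ^ m) * P r) * (Real.exp (-A * r) * (1 + 2 * (C * r ^ m))) := by ring
      _ ≤ P (φ (r * u)) * Real.exp (-A * ‖φ (r * u)‖) := by
          refine mul_le_mul h7 h8 (by positivity) hPφ.le

end IsRadialFlat

/-! ### Normalisation along z₁ = 0 -/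

namespace PreservesGraph
open Filter Asymptotics IsModelGerm

variable {P : ℂ → ℝ} {Q : ℂ → ℝ → ℝ} {F₁ F₂ : ℂ × ℂ → ℂ}

theorem norm_deriv_snd_eq_one (hF : PreservesGraph P Q F₁ F₂) (h : IsModelGerm P Q)
    (h0 : partialFst F₁ 0 ≠ 0) : ‖deriv (fun w : ℂ => F₂ (0, w)) 0‖ = 1 :=
  h.norm_deriv_eq_one (hF.re_coeff_pos h h0) hF.analytic₂.comp_zero_snd hF.map_zero₂
    (hF.tendsto_ratio h)

/-- By the Lipschitz bound Q∘φ - Q has the order of φ - id. The order-one relation passes this order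
to Im H, and holomorphy passes it to H - H(0). -/
theorem coeff_sub_isBigO (hF : PreservesGraph P Q F₁ F₂) (h : IsModelGerm P Q) {m : ℕ}
    (hm : (fun z : ℂ => F₂ (0, z) - z) =O[𝓝 0] fun z => ‖z‖ ^ m) :
    (fun z => partialFst F₁ (0, z) - partialFst F₁ 0) =O[𝓝 0] fun z => ‖z‖ ^ m := by
  have hQd : (fun z => Q (F₂ (0, z)) 0 - Q z 0) =O[𝓝[≠] 0] fun z => ‖z‖ ^ m := by
    have h1 := h.sub_isBigO₂ hF.tendsto_snd_zero tendsto_id (tendsto_const_nhds (x := 0))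
      (tendsto_const_nhds (x := 0))
    simp only [sub_zero, norm_zero, add_zero] at h1
    exact (h1.trans hm.norm_left).mono nhdsWithin_le_nhds
  have hre := hF.tendsto_re_coeff.isBigO_one ℝ
  have h2 : Tendsto (fun z => 1 + Q z 0 * Q (F₂ (0, z)) 0) (𝓝[≠] 0) (𝓝 1) := by
    simpa using ((tendsto_Q h).mul (hF.tendsto_Q_snd h)).const_add 1
  have h3 : (fun z => (partialFst F₁ (0, z)).im) =O[𝓝[≠] 0] fun z => ‖z‖ ^ m := by
    have h4 := hre.mul hQd
    simp only [one_mul] at h4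
    have h5 := ((hF.im_coeff_isBigO h m).add h4).mul ((h2.inv₀ one_ne_zero).isBigO_one ℝ)
    simp only [mul_one] at h5
    refine h5.congr' ?_ EventuallyEq.rfl
    filter_upwards [h2.eventually_ne one_ne_zero] with z hz
    field_simp
    ring
  -- The factor -i turns the imaginary part into a real part.
  have han : AnalyticAt ℂ (fun z => -Complex.I * (partialFst F₁ (0, z) - partialFst F₁ 0)) 0 :=
    analyticAt_const.mul (hF.analyticAt_coeff.sub analyticAt_const)
  have h6 := han.isBigO_pow_of_re (q := fun _ => 0) (n := m) (by simp [← Prod.mk_zero_zero])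
    tendsto_const_nhds (h3.congr_left fun z => by simp [hF.im_coeff_zero h])
  have h7 := h6.const_mul_left Complex.I
  refine h7.congr_left fun z => ?_
  rw [← mul_assoc]; simp

/-- If its derivative at `0` is `1`, the restriction to `z₁ = 0` is the identity. -/
theorem eventually_snd_eq (hF : PreservesGraph P Q F₁ F₂) (h : IsModelGerm P Q)
    (h1 : deriv (fun w : ℂ => F₂ (0, w)) 0 = 1) : ∀ᶠ w in 𝓝 (0 : ℂ), F₂ (0, w) = w := by
  have hφ := hF.analytic₂.comp_zero_snd
  have hφ0 : F₂ (0, (0 : ℂ)) = 0 := hF.map_zero₂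
  have hd : AnalyticAt ℂ (fun w : ℂ => F₂ (0, w) - w) 0 := hφ.sub analyticAt_id
  by_contra hne
  obtain ⟨m, c, hc, hmc⟩ := hd.exists_leading_term fun h0 => hne (h0.mono fun w hw => sub_eq_zero.1 hw)
  have hlo : (fun w : ℂ => F₂ (0, w) - w) =o[𝓝 0] fun w : ℂ => ‖w‖ ^ 1 := by
    have := hφ.differentiableAt.hasDerivAt.isLittleO
    simpa [h1, hφ0] using this.norm_right
  have hm : 2 ≤ m := by
    by_contra hlt
    have h2 : (fun w : ℂ => c * w ^ m) =o[𝓝 0] fun w : ℂ => ‖w‖ ^ m := by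
      have h3 := hlo.trans_isBigO (isBigO_norm_pow_of_le (E := ℂ) (show m ≤ 1 by omega))
      have h4 := hmc.trans_isLittleO (g := fun w : ℂ => ‖w‖ ^ (m + 1)) (k := fun w : ℂ => ‖w‖ ^ m)
        ((isLittleO_pow_pow (Nat.lt_succ_self m)).comp_tendsto tendsto_norm_zero)
      refine (h3.sub h4).congr_left fun w => by ring
    refine not_const_mul_pow_isLittleO (norm_ne_zero_iff.2 hc) (l := m) (le_refl (𝓝[>] (0 : ℝ))) ?_
    have h5 := (h2.comp_tendsto (tendsto_ofReal_punctured.mono_right nhdsWithin_le_nhds)).norm_norm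
    refine (h5.congr' ?_ ?_).of_norm_right
    · filter_upwards [self_mem_nhdsWithin] with r hr
      have hr0 : (0 : ℝ) < r := hr
      simp [abs_of_pos hr0]
    · filter_upwards [self_mem_nhdsWithin] with r hr
      simp
  have hdm : (fun z : ℂ => F₂ (0, z) - z) =O[𝓝 0] fun z => ‖z‖ ^ m := by
    have h1 : (fun z : ℂ => c * z ^ m) =O[𝓝 0] fun z => ‖z‖ ^ m :=
      IsBigO.of_bound ‖c‖ (Eventually.of_forall fun z => by simp)
    simpa using (hmc.trans (isBigO_norm_pow_of_le (Nat.le_succ m))).add h1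
  have hco := (hF.coeff_sub_isBigO h hdm).mono (nhdsWithin_le_nhds (s := {0}ᶜ))
  have hre : (fun z => (partialFst F₁ (0, z)).re - (partialFst F₁ 0).re) =O[𝓝[≠] 0]
      fun z => ‖z‖ ^ m :=
    (isBigO_of_le _ fun z => by rw [← Complex.sub_re]; exact Complex.abs_re_le_norm _).trans hco
  have him : (fun z => (partialFst F₁ (0, z)).im) =O[𝓝[≠] 0] fun z => ‖z‖ ^ m := by
    refine (isBigO_of_le _ fun z => ?_).trans hco
    have := Complex.abs_im_le_norm (partialFst F₁ (0, z) - partialFst F₁ 0)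
    rwa [Complex.sub_im, hF.im_coeff_zero h, sub_zero] at this
  have him' := him.mul ((hF.tendsto_Q_snd h).isBigO_one ℝ)
  simp only [mul_one] at him'
  -- The quotient P∘φ/P is constant to exactly the order m of contact between φ and the identity,
  -- which is what is impossible.
  refine h.not_ratio_isBigO hφ hφ0 hc hm hmc (a := (partialFst F₁ 0).re) ?_
  refine (((hF.ratio_sub_isBigO h m).add hre).add him').congr_left fun z => ?_
  ring

/-- With φ = id the difference H - H(0) is flat, so H is constant; its value is the limit of P∘φ/P =
1. -/
theorem eventually_coeff_eq_one (hF : PreservesGraph P Q F₁ F₂) (h : IsModelGerm P Q)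
    (h1 : deriv (fun w : ℂ => F₂ (0, w)) 0 = 1) :
    ∀ᶠ w in 𝓝 (0 : ℂ), partialFst F₁ (0, w) = 1 := by
  have hsnd := hF.eventually_snd_eq h h1
  have h2 : ∀ᶠ w in 𝓝 (0 : ℂ), partialFst F₁ (0, w) - partialFst F₁ 0 = 0 := by
    refine (hF.analyticAt_coeff.sub analyticAt_const).eventually_eq_zero_of_isBigO_pow fun N => ?_
    refine hF.coeff_sub_isBigO h ((isBigO_zero (fun z : ℂ => ‖z‖ ^ N) (𝓝 0)).congr' ?_
      EventuallyEq.rfl)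
    filter_upwards [hsnd] with w hw
    simp [hw]
  have h3 : (partialFst F₁ 0).re = 1 := by
    refine tendsto_nhds_unique ((hF.tendsto_ratio h).congr' ?_) tendsto_const_nhds
    filter_upwards [h.eventually_pos, hsnd.filter_mono nhdsWithin_le_nhds] with z hz hz'
    rw [hz', div_self hz.ne']
  have h4 : partialFst F₁ 0 = 1 := Complex.ext h3 (hF.im_coeff_zero h)
  filter_upwards [h2] with w hw
  rw [← h4]; exact sub_eq_zero.1 hw

end PreservesGraph

/-! ### Higher orders of the invariance equation -/

open Filter Asymptotics Polynomial in
/-- Evaluation of a polynomial identity in `s = iτ` at `s = 1`, by Lagrange interpolation. -/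
theorem sub_two_mul_isLittleO {ι : Type*} {l : Filter ι} {A B : ι → ℂ} {G : ι → ℝ} {j : ℕ}
    (hj : 1 ≤ j) (h : ∀ τ : ℝ, (fun x => ((-1 + τ * Complex.I) ^ j *
      ((-1 + τ * Complex.I) * A x + B x)).re) =o[l] G) :
    (fun x => B x - 2 * A x) =o[l] G := by
  -- For s = iτ the conjugate of s - 1 is -(s + 1), so f(iτ) is twice the given real part. At s = 1
  -- the first summand vanishes because j ≥ 1, and only the conjugate of B - 2A survives. The degree
  -- is at most j + 1, so j + 2 imaginary nodes determine f(1).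
  let f : ι → ℂ[X] := fun x => (X - 1) ^ j * ((X - 1) * C (A x) + C (B x)) +
    C ((-1) ^ j) * ((X + 1) ^ j * (C (star (B x)) - (X + 1) * C (star (A x))))
  have hdeg : ∀ x, (f x).degree < (Finset.range (j + 2)).card := by
    intro x
    rw [Finset.card_range]
    have h1 : (X - 1 : ℂ[X]).natDegree ≤ 1 := by compute_degree
    have h2 : (X + 1 : ℂ[X]).natDegree ≤ 1 := by compute_degree
    have h3 : (f x).natDegree ≤ j + 1 := by
      refine natDegree_add_le_of_degree_le ?_ ?_
      · refine natDegree_mul_le_of_le (by simpa using natDegree_pow_le_of_le j h1) ?_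
        compute_degree
      · refine (natDegree_C_mul_le _ _).trans ?_
        refine natDegree_mul_le_of_le (by simpa using natDegree_pow_le_of_le j h2) ?_
        compute_degree
    refine (natDegree_le_iff_degree_le.1 h3).trans_lt ?_
    exact_mod_cast Nat.lt_succ_self (j + 1)
  let v : ℕ → ℂ := fun n => ((n : ℝ) : ℂ) * Complex.I
  have hv : Set.InjOn v (Finset.range (j + 2)) := by
    intro a _ b _ hab
    have : ((a : ℝ) : ℂ) = ((b : ℝ) : ℂ) := mul_right_cancel₀ Complex.I_ne_zero hab
    exact_mod_cast this
  have hev : ∀ x, ∀ τ : ℝ, (f x).eval (τ * Complex.I) =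
      ((2 * ((-1 + τ * Complex.I) ^ j * ((-1 + τ * Complex.I) * A x + B x)).re : ℝ) : ℂ) := by
    intro x τ
    rw [← Complex.add_conj]
    simp only [f, eval_add, eval_mul, eval_pow, eval_sub, eval_X, eval_one, eval_C, map_mul,
      map_pow, map_add, map_neg, map_one, eval_neg, Complex.conj_ofReal, Complex.conj_I]
    have h1 : (-1 + (τ : ℂ) * -Complex.I) ^ j = (-1) ^ j * ((τ : ℂ) * Complex.I + 1) ^ j := by
      rw [← mul_pow]; congr 1; ring
    rw [h1]
    simp only [Complex.star_def]
    ring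
  have hone : ∀ x, (f x).eval 1 = (-2) ^ j * star (B x - 2 * A x) := by
    intro x
    have h0 : (0 : ℂ) ^ j = 0 := zero_pow (by omega)
    have h1 : ((-2 : ℂ)) ^ j = (-1) ^ j * 2 ^ j := by rw [← mul_pow]; norm_num
    simp only [f, eval_add, eval_mul, eval_pow, eval_sub, eval_X, eval_one, eval_C, sub_self, h0,
      h1, star_sub, star_mul']
    norm_num
    ring
  have hsum : ∀ x, (f x).eval 1 = ∑ i ∈ Finset.range (j + 2),
      (f x).eval (v i) * (Lagrange.basis (Finset.range (j + 2)) v i).eval 1 := by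
    intro x
    conv_lhs => rw [Lagrange.eq_interpolate hv (hdeg x), Lagrange.interpolate_apply]
    simp [eval_finsetSum]
  have hlit : (fun x => (f x).eval 1) =o[l] G := by
    simp only [hsum]
    refine IsLittleO.fun_sum fun i _ => ?_
    have h1 : (fun x => (f x).eval (v i)) =o[l] G := by
      simp only [v, hev]
      refine IsLittleO.congr_left (f₁ := fun x => ((2 * ((-1 + (i : ℝ) * Complex.I) ^ j *
        ((-1 + (i : ℝ) * Complex.I) * A x + B x)).re : ℝ) : ℂ)) ?_ (fun x => rfl)
      exact Complex.isLittleO_ofReal_left.2 ((h i).const_mul_left 2)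
    exact (h1.const_mul_left ((Lagrange.basis (Finset.range (j + 2)) v i).eval 1)).congr_left
      fun x => mul_comm _ _
  have h2 : (fun x => star (B x - 2 * A x)) =o[l] G := by
    have := hlit.const_mul_left (((-2 : ℂ) ^ j)⁻¹)
    refine this.congr_left fun x => ?_
    rw [hone, inv_mul_cancel_left₀ (pow_ne_zero _ (by norm_num))]
  exact IsLittleO.of_norm_left (h2.norm_left.congr_left fun x => norm_star _)

namespace PreservesGraph
open Filter Asymptotics IsModelGerm

variable {P : ℂ → ℝ} {Q : ℂ → ℝ → ℝ} {F₁ F₂ : ℂ × ℂ → ℂ}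

theorem graphPoint_div_isBigO (h : IsModelGerm P Q) (τ : ℝ) {F : ℂ × ℂ → ℂ} (n : ℕ)
    (hF : AnalyticAt ℂ F 0)
    (h0 : ∀ m < n, ∀ᶠ w in 𝓝 (0 : ℂ), partialFst^[m] F (0, w) = 0) :
    (fun z => F (graphPoint P Q τ z) / (P z : ℂ) ^ n - graphSlope P Q τ z ^ n *
      (partialFst^[n] F (0, z) / n.factorial)) =O[𝓝[≠] 0] P := by
  have h1 := ((graphPoint_sub_isBigO h τ n hF h0).mono (nhdsWithin_le_nhds (s := {0}ᶜ))).mul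
    (isBigO_of_le (g := fun z => (P z ^ n)⁻¹) (𝓝[≠] 0)
      (f := fun z => ((P z : ℂ) ^ n)⁻¹) (fun z => by simp))
  refine h1.congr' ?_ ?_
  · filter_upwards [h.eventually_pos] with z hz
    have : (P z : ℂ) ≠ 0 := by exact_mod_cast hz.ne'
    rw [mul_pow]
    field_simp
  · filter_upwards [h.eventually_pos] with z hz
    rw [pow_succ]
    field_simp

/-- The leading part of the invariance equation for a map tangent to the identity
to order `j` along `z₁ = 0`. -/
theorem leading_eq (hF : PreservesGraph P Q F₁ F₂) (h : IsModelGerm P Q) {j : ℕ} (hj : 1 ≤ j)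
    (hV : ∀ m < j + 1, ∀ᶠ w in 𝓝 (0 : ℂ), partialFst^[m] (fun z => F₁ z - z.1) (0, w) = 0)
    (hW : ∀ m < j, ∀ᶠ w in 𝓝 (0 : ℂ), partialFst^[m] (fun z => F₂ z - z.2) (0, w) = 0)
    {α β : ℂ → ℂ}
    (hα : ∀ w, α w = partialFst^[j + 1] (fun z => F₁ z - z.1) (0, w) / (j + 1).factorial)
    (hβ : ∀ w, β w = partialFst^[j] (fun z => F₂ z - z.2) (0, w) / j.factorial)
    {l : Filter ℂ} (hl : l ≤ 𝓝[≠] 0) {G : ℂ → ℝ} (hαG : α =O[l] G)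
    (hβG : (fun z => (P z)⁻¹ * ‖fderiv ℝ P z‖ * ‖β z‖) =O[l] G) (hβo : β =o[l] G)
    {N : ℕ} (hN : (fun z => ‖z‖ ^ N) =o[l] G) (τ : ℝ) :
    (fun z => ((-1 + τ * Complex.I) ^ (j + 1) * α z).re +
      (P z)⁻¹ * fderiv ℝ P z ((-1 + τ * Complex.I) ^ j * β z)) =o[l] G := by
  have hl0 : l ≤ 𝓝 0 := hl.trans nhdsWithin_le_nhds
  have hpos : ∀ᶠ z in l, 0 < P z := hl h.eventually_pos
  set ζ := graphSlope P Q τ with hζ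
  set ξ : ℂ := -1 + τ * Complex.I with hξ
  have hζt : Tendsto ζ l (𝓝 ξ) := (h.tendsto_graphSlope τ).mono_left hl0
  have hPG : P =o[l] G := ((h.isBigO_pow N).mono hl0).trans_isLittleO hN
  have hDG : (fun z => fderiv ℝ P z) =o[l] G :=
    ((h.fderiv_isBigO_pow N).mono hl0).trans_isLittleO hN
  have hPt : Tendsto P l (𝓝 0) := h.tendsto_zero.mono_left hl0
  have hanV : AnalyticAt ℂ (fun z : ℂ × ℂ => F₁ z - z.1) 0 := hF.analytic₁.sub analyticAt_fst
  have hanW : AnalyticAt ℂ (fun z : ℂ × ℂ => F₂ z - z.2) 0 := hF.analytic₂.sub analyticAt_snd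
  set M := graphPoint P Q τ with hM
  -- `v` and `w` are the displacements of the test point, scaled so that their leading parts are
  -- ζ^(j+1)α and ζ^jβ.
  set v : ℂ → ℂ := fun z => (F₁ (M z) - (M z).1) / (P z : ℂ) ^ (j + 1) with hv
  set w : ℂ → ℂ := fun z => (F₂ (M z) - z) / (P z : ℂ) ^ j with hw
  have hdiff : ∀ k : ℕ, (fun z => ζ z ^ k - ξ ^ k) =o[l] fun _ => (1 : ℝ) := fun k =>
    (isLittleO_one_iff ℝ).2 (by simpa using (hζt.pow k).sub_const (ξ ^ k))
  have hv1 : (fun z => v z - ξ ^ (j + 1) * α z) =o[l] G := by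
    have h1 : (fun z => v z - ζ z ^ (j + 1) * α z) =o[l] G := by
      simp only [hα]
      exact ((graphPoint_div_isBigO h τ (j + 1) hanV hV).mono hl).trans_isLittleO hPG
    have h2 := (hdiff (j + 1)).mul_isBigO hαG
    simp only [one_mul] at h2
    exact (h1.add h2).congr_left fun z => by ring
  have hvG : v =O[l] G := by
    simpa using hv1.isBigO.add (hαG.const_mul_left (ξ ^ (j + 1)))
  have hw1 : (fun z => w z - ζ z ^ j * β z) =O[l] P := by
    simp only [hβ]
    exact (graphPoint_div_isBigO h τ j hanW hW).mono hl
  have hζb : ∀ k : ℕ, (fun z => ζ z ^ k) =O[l] fun _ => (1 : ℝ) := fun k => (hζt.pow k).isBigO_one ℝ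
  have hwo : w =o[l] G := by
    have h2 := (hζb j).mul_isLittleO hβo
    simp only [one_mul] at h2
    simpa using (hw1.trans_isLittleO hPG).add h2
  have hwb : w =O[l] fun _ => (1 : ℝ) := by
    have h2 : β =O[l] fun _ => (1 : ℝ) := by
      have : AnalyticAt ℂ β 0 := by
        have h3 : β = fun z => partialFst^[j] (fun z => F₂ z - z.2) (0, z) * (j.factorial : ℂ)⁻¹ := by
          funext z; rw [hβ]; rfl
        rw [h3]
        exact (hanW.iterate_partialFst j).comp_zero_snd.mul analyticAt_const
      exact (this.continuousAt.isBigO_one ℝ).mono hl0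
    have h3 := (hζb j).mul h2
    simp only [one_mul] at h3
    simpa using (hw1.trans (hPt.isBigO_one ℝ)).add h3
  -- the linear term
  have hlin : (fun z => (P z)⁻¹ * fderiv ℝ P z (w z) - (P z)⁻¹ * fderiv ℝ P z (ξ ^ j * β z))
      =o[l] G := by
    have h1 : (fun z => (P z)⁻¹ * fderiv ℝ P z (w z - ζ z ^ j * β z)) =o[l] G := by
      have h2 : (fun z => (P z)⁻¹ * fderiv ℝ P z (w z - ζ z ^ j * β z)) =O[l]
          fun z => (P z)⁻¹ * (‖fderiv ℝ P z‖ * P z) := by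
        refine (isBigO_refl (fun z => (P z)⁻¹) l).mul ?_
        refine (isBigO_of_le (g := fun z => ‖fderiv ℝ P z‖ * ‖w z - ζ z ^ j * β z‖) l
          fun z => ?_).trans ((isBigO_refl (fun z => ‖fderiv ℝ P z‖) l).mul hw1.norm_left)
        simpa using (fderiv ℝ P z).le_opNorm (w z - ζ z ^ j * β z)
      refine (h2.congr' EventuallyEq.rfl ?_).trans_isLittleO hDG.norm_left
      filter_upwards [hpos] with z hz
      field_simp
    have h2 : (fun z => (P z)⁻¹ * fderiv ℝ P z ((ζ z ^ j - ξ ^ j) * β z)) =o[l] G := by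
      have h3 := (hdiff j).norm_left.mul_isBigO hβG
      simp only [one_mul] at h3
      refine IsBigO.trans_isLittleO (isBigO_of_le _ fun z => ?_) h3
      have := (fderiv ℝ P z).le_opNorm ((ζ z ^ j - ξ ^ j) * β z)
      simp only [norm_mul, norm_norm] at this ⊢
      calc ‖(P z)⁻¹‖ * ‖fderiv ℝ P z ((ζ z ^ j - ξ ^ j) * β z)‖
          ≤ ‖(P z)⁻¹‖ * (‖fderiv ℝ P z‖ * (‖ζ z ^ j - ξ ^ j‖ * ‖β z‖)) := by gcongr
        _ = _ := by ring
    refine (h1.add h2).congr_left fun z => ?_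
    rw [← mul_add, ← mul_sub, ← map_add, ← map_sub]
    congr 2; ring
  -- the quadratic remainder
  have hquad : (fun z => (P (F₂ (M z)) - P z - fderiv ℝ P z (F₂ (M z) - z)) / P z ^ (j + 1))
      =o[l] G := by
    have h1 := (h.sub_sub_fderiv_isBigO (hF.graphPoint₂_isBigO h τ)
      (b := fun z => z) (isBigO_refl (fun z : ℂ => z) _).norm_right tendsto_norm_zero N).mono hl0
    have h2 : (fun z => ‖F₂ (M z) - z‖ ^ 2) =O[l] fun z => P z ^ (j + 1) := by
      have h3 : (fun z => F₂ (M z) - z) =O[l] fun z => P z ^ j := by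
        have h4 := hwb.mul (isBigO_of_le (f := fun z => (P z : ℂ) ^ j) (g := fun z => P z ^ j) l
          fun z => by simp)
        refine h4.congr' ?_ (Eventually.of_forall fun z => by simp)
        filter_upwards [hpos] with z hz
        have : (P z : ℂ) ≠ 0 := by exact_mod_cast hz.ne'
        simp only [hw]; field_simp
      obtain ⟨k, rfl⟩ : ∃ k, j = k + 1 := ⟨j - 1, by omega⟩
      refine (h3.norm_left.pow 2).trans ?_
      have h5 : (fun z => P z ^ (k + 1 + 1) * P z ^ k) =O[l] fun z => P z ^ (k + 1 + 1) * 1 :=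
        (isBigO_refl _ _).mul ((hPt.pow k).isBigO_one ℝ)
      refine h5.congr (fun z => by ring) (fun z => by ring)
    have h3 := (h1.trans ((isBigO_refl (fun z : ℂ => ‖z‖ ^ N) l).mul h2)).mul
      (isBigO_refl (fun z => (P z ^ (j + 1))⁻¹) l)
    refine (h3.congr' (Eventually.of_forall fun z => (div_eq_mul_inv _ _).symm) ?_).trans_isLittleO hN
    filter_upwards [hpos] with z hz
    field_simp
  -- the terms with `Q`
  have hQt : Tendsto (fun z => Q (F₂ (M z)) (F₁ (M z)).im) l (𝓝 0) :=
    (h.tendsto_zero₂ (hF.tendsto_graphPoint₂ h τ) (hF.tendsto_graphPoint₁_im h τ)).mono_left hl0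
  have hQ1 : (fun z => (v z).im * Q (F₂ (M z)) (F₁ (M z)).im) =o[l] G := by
    have h1 := (((isBigO_of_le l fun z => Complex.abs_im_le_norm (v z)).trans hvG).mul_isLittleO
      ((isLittleO_one_iff ℝ).2 hQt))
    simpa using h1
  have hQ2 : (fun z => (Q (F₂ (M z)) (F₁ (M z)).im - Q z (M z).1.im) / P z ^ j) =o[l] G := by
    have ht : Tendsto (fun z => (M z).1.im) (𝓝 0) (𝓝 0) := by
      simp only [hM, graphPoint_im]
      simpa using h.tendsto_zero.const_mul τ
    have h1 := (h.sub_isBigO₂ (hF.tendsto_graphPoint₂ h τ) tendsto_id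
      (hF.tendsto_graphPoint₁_im h τ) ht).mono hl0
    have h2 := h1.mul (isBigO_refl (fun z => (P z ^ j)⁻¹) l)
    have h3 : (fun z => ‖w z‖ + ‖v z‖ * P z) =o[l] G := by
      refine hwo.norm_left.add ?_
      have := hvG.norm_left.mul_isLittleO ((isLittleO_one_iff ℝ).2 hPt)
      simpa using this
    refine (h2.congr_left fun z => (div_eq_mul_inv _ _).symm).trans_isLittleO
      (IsBigO.trans_isLittleO ?_ h3)
    refine IsBigO.of_bound 1 ?_
    filter_upwards [hpos] with z hz
    have e1 : ‖F₂ (M z) - z‖ = ‖w z‖ * P z ^ j := by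
      simp only [hw, norm_div, norm_pow, Complex.norm_real, Real.norm_of_nonneg hz.le]
      field_simp
    have e2 : ‖(F₁ (M z)).im - (M z).1.im‖ ≤ ‖v z‖ * P z ^ (j + 1) := by
      have : ‖v z‖ * P z ^ (j + 1) = ‖F₁ (M z) - (M z).1‖ := by
        simp only [hv, norm_div, norm_pow, Complex.norm_real, Real.norm_of_nonneg hz.le]
        field_simp
      rw [this, ← Complex.sub_im]
      exact Complex.abs_im_le_norm _
    have hA : 0 ≤ (‖F₂ (M z) - id z‖ + ‖(F₁ (M z)).im - (M z).1.im‖) * (P z ^ j)⁻¹ := by positivity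
    have hB : 0 ≤ ‖w z‖ + ‖v z‖ * P z := by positivity
    change ‖(‖F₂ (M z) - id z‖ + ‖(F₁ (M z)).im - (M z).1.im‖) * (P z ^ j)⁻¹‖ ≤ _
    rw [Real.norm_of_nonneg hA, Real.norm_of_nonneg hB, one_mul,
      ← div_eq_mul_inv, div_le_iff₀ (by positivity)]
    calc ‖F₂ (M z) - id z‖ + ‖(F₁ (M z)).im - (M z).1.im‖
        ≤ ‖w z‖ * P z ^ j + ‖v z‖ * P z ^ (j + 1) := add_le_add e1.le e2
      _ = (‖w z‖ + ‖v z‖ * P z) * P z ^ j := by ring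
  have hre : (fun z => (v z - ξ ^ (j + 1) * α z).re) =o[l] G :=
    (isBigO_of_le l fun z => Complex.abs_re_le_norm _).trans_isLittleO hv1
  have hsum := ((((hre.add hlin).add hquad).add hQ1).add (hQ2.const_mul_left τ)).neg_left
  refine hsum.congr' ?_ EventuallyEq.rfl
  filter_upwards [hpos, hl0 (hF.graphPoint_eq h τ)] with z hz hz'
  have hp : P z ≠ 0 := hz.ne'
  have hpow : ((P z : ℂ) ^ (j + 1)) = ((P z ^ (j + 1) : ℝ) : ℂ) := by push_cast; rfl
  have hgf : graphFunction P Q (M z) = 0 := graphFunction_graphPoint τ z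
  have him : (M z).1.im = τ * P z := graphPoint_im τ z
  have hM2 : (M z).2 = z := rfl
  rw [graphFunction, hM2] at hgf
  have e1 : (v z).re * P z ^ (j + 1) = (F₁ (M z)).re - (M z).1.re := by
    simp only [hv, hpow, Complex.div_ofReal_re, Complex.sub_re]
    field_simp
  have e2 : (v z).im * P z ^ (j + 1) = (F₁ (M z)).im - (M z).1.im := by
    simp only [hv, hpow, Complex.div_ofReal_im, Complex.sub_im]
    field_simp
  have e3 : (P z)⁻¹ * fderiv ℝ P z (w z) = fderiv ℝ P z (F₂ (M z) - z) / P z ^ (j + 1) := by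
    have : w z = ((P z ^ j)⁻¹ : ℝ) • (F₂ (M z) - z) := by
      simp only [hw, Complex.real_smul]; push_cast; rw [div_eq_inv_mul]
    rw [this, map_smul, smul_eq_mul, pow_succ]
    field_simp
  -- The equation at the test point is subtracted from the equation at its image and divided by
  -- P^(j+1). The difference of the `Q` values carries the factor Im z₁ = τP, which leaves only P^j
  -- below it.
  have key : (v z).re + (P (F₂ (M z)) - P z) / P z ^ (j + 1) +
      (v z).im * Q (F₂ (M z)) (F₁ (M z)).im +
      τ * ((Q (F₂ (M z)) (F₁ (M z)).im - Q z (M z).1.im) / P z ^ j) = 0 := by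
    have hne : P z ^ (j + 1) ≠ 0 := pow_ne_zero _ hp
    refine mul_right_cancel₀ hne ?_
    have e4 : τ * ((Q (F₂ (M z)) (F₁ (M z)).im - Q z (M z).1.im) / P z ^ j) * P z ^ (j + 1) =
        (M z).1.im * (Q (F₂ (M z)) (F₁ (M z)).im - Q z (M z).1.im) := by
      rw [him, pow_succ]; field_simp
    have e5 : (P (F₂ (M z)) - P z) / P z ^ (j + 1) * P z ^ (j + 1) = P (F₂ (M z)) - P z := by
      field_simp
    rw [add_mul, add_mul, add_mul, e4, e5, e1, mul_right_comm, e2]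
    linear_combination hz' - hgf
  rw [sub_div, ← e3]
  simp only [Complex.sub_re]
  linear_combination (-1 : ℝ) * key

end PreservesGraph

/-! ### Comparison of directions -/

open Filter Asymptotics in
theorem AnalyticAt.exists_isEquivalent {g : ℂ → ℂ} (hg : AnalyticAt ℂ g 0)
    (h0 : ¬ ∀ᶠ z in 𝓝 0, g z = 0) :
    ∃ (l : ℕ) (c : ℂ), c ≠ 0 ∧ g ~[𝓝 0] fun z => c * z ^ l := by
  obtain ⟨l, c, hc, h⟩ := hg.exists_leading_term h0
  refine ⟨l, c, hc, ?_⟩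
  have h1 : (fun z : ℂ => ‖z‖ ^ (l + 1)) =o[𝓝 0] fun z : ℂ => ‖z‖ ^ l :=
    (isLittleO_pow_pow (Nat.lt_succ_self l)).comp_tendsto tendsto_norm_zero
  refine (h.trans_isLittleO h1).trans_isBigO (IsBigO.of_bound ‖c‖⁻¹ (Eventually.of_forall fun z => ?_))
  have : ‖c‖ ≠ 0 := norm_ne_zero_iff.2 hc
  simp only [norm_pow, norm_norm, norm_mul]
  rw [inv_mul_cancel_left₀ this]

theorem eq_of_forall_unit_pow_eq {k l : ℕ} (h : ∀ u : ℂ, ‖u‖ = 1 → u ^ k = u ^ l) : k = l := by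
  wlog hkl : k ≤ l generalizing k l
  · exact (this (fun u hu => (h u hu).symm) (le_of_not_ge hkl)).symm
  by_contra hne
  obtain ⟨u, hu, hu'⟩ := exists_unit_mul_pow_eq (c := 1) (w := -1) one_ne_zero (by simp)
    (show l - k ≠ 0 by omega)
  have h1 := h u hu
  have hu0 : u ≠ 0 := by rintro rfl; simp at hu
  rw [show l = k + (l - k) by omega, pow_add] at h1
  have h2 : u ^ (l - k) = 1 := by
    have := mul_left_cancel₀ (pow_ne_zero k hu0) ((mul_one (u ^ k)).trans h1)
    exact this.symm
  rw [h2] at hu'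
  norm_num at hu'

open Filter Asymptotics in
theorem isLittleO_left_of_sub_two_mul {ι : Type*} {l : Filter ι} {A B : ι → ℂ}
    (h : (fun x => B x - 2 * A x) =o[l] fun x => ‖A x‖ + ‖B x‖) :
    (fun x => B x - 2 * A x) =o[l] A := by
  refine IsLittleO.of_bound fun ε hε => ?_
  -- Since ‖B‖ ≤ ‖B - 2A‖ + 2‖A‖, the hypothesis gives ‖B - 2A‖ ≤ δ(3‖A‖ + ‖B - 2A‖). The bound δ ≤
  -- 1/2 absorbs the last term, and 6δ ≤ ε finishes.
  have hδ : 0 < min (1 / 2) (ε / 6) := by positivity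
  filter_upwards [h.def hδ] with x hx
  rw [Real.norm_of_nonneg (by positivity)] at hx
  have h1 : ‖B x‖ ≤ ‖B x - 2 * A x‖ + 2 * ‖A x‖ := by
    have := norm_add_le (B x - 2 * A x) (2 * A x)
    simpa using this
  have h2 := min_le_left (1 / 2) (ε / 6)
  have h3 := min_le_right (1 / 2) (ε / 6)
  set δ := min (1 / 2) (ε / 6)
  have hA := norm_nonneg (A x)
  have hE := norm_nonneg (B x - 2 * A x)
  have h4 : ‖B x - 2 * A x‖ ≤ δ * (3 * ‖A x‖ + ‖B x - 2 * A x‖) :=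
    hx.trans (mul_le_mul_of_nonneg_left (by linarith) hδ.le)
  nlinarith [mul_le_mul_of_nonneg_right h2 hE, mul_le_mul_of_nonneg_right h3 hA]

open Filter Asymptotics in
/-- No two holomorphic germs can satisfy `L(r) ū β(ru) ∼ 2 α(ru)` in every direction `u`
along radii on which `r L(r) → ∞`. -/
theorem false_of_isLittleO_all_directions {α β : ℂ → ℂ} (hα : AnalyticAt ℂ α 0)
    (hβ : AnalyticAt ℂ β 0) (hne : ¬ ((∀ᶠ z in 𝓝 0, α z = 0) ∧ ∀ᶠ z in 𝓝 0, β z = 0))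
    {l : Filter ℝ} [l.NeBot] (hl : l ≤ 𝓝[>] 0) {L : ℝ → ℝ}
    (hL : Tendsto (fun r => r * L r) l atTop)
    (h : ∀ u : ℂ, ‖u‖ = 1 → (fun r : ℝ => L r * star u * β (r * u) - 2 * α (r * u)) =o[l]
      fun r => ‖α (r * u)‖ + ‖L r * star u * β (r * u)‖) : False := by
  have hray : ∀ u : ℂ, ‖u‖ = 1 → Tendsto (fun r : ℝ => (r : ℂ) * u) l (𝓝[≠] 0) := fun u hu =>
    (tendsto_ofReal_mul_punctured (by rintro rfl; simp at hu)).mono_left hl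
  have hray0 : ∀ u : ℂ, ‖u‖ = 1 → Tendsto (fun r : ℝ => (r : ℂ) * u) l (𝓝 0) := fun u hu =>
    (hray u hu).mono_right nhdsWithin_le_nhds
  have hrpos : ∀ᶠ r in l, 0 < r := hl self_mem_nhdsWithin
  have hLpos : ∀ᶠ r in l, 0 < L r := by
    filter_upwards [hrpos, hL.eventually_gt_atTop 0] with r h1 h2
    exact pos_of_mul_pos_right h2 h1.le
  have h' := fun u hu => isLittleO_left_of_sub_two_mul (h u hu)
  have h1 : ‖(1 : ℂ)‖ = 1 := norm_one
  have hα0 : ¬ ∀ᶠ z in 𝓝 0, α z = 0 := by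
    intro h0
    have hβ0 := (hβ.eventually_eq_zero_or_eventually_ne_zero).resolve_left fun h2 => hne ⟨h0, h2⟩
    have h3 := (h' 1 h1).congr' EventuallyEq.rfl ((hray0 1 h1).eventually h0)
    obtain ⟨r, ⟨⟨h4, h5⟩, h6⟩, h7⟩ := (((isLittleO_zero_right_iff.1 h3).and
      ((hray 1 h1).eventually hβ0)).and hLpos).and ((hray0 1 h1).eventually h0) |>.exists
    simp only [Pi.zero_apply] at h4
    rw [h7] at h4
    have hL0 : (L r : ℂ) ≠ 0 := by exact_mod_cast h6.ne'
    simp [hL0] at h4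
    exact h5 (by simpa using h4)
  have hβ0 : ¬ ∀ᶠ z in 𝓝 0, β z = 0 := by
    intro h0
    have hα1 := (hα.eventually_eq_zero_or_eventually_ne_zero).resolve_left hα0
    have h3 := (h' 1 h1).def (c := 1) one_pos
    obtain ⟨r, ⟨h4, h5⟩, h7⟩ := ((h3.and ((hray 1 h1).eventually hα1)).and
      ((hray0 1 h1).eventually h0)).exists
    rw [h7] at h4
    simp at h4
    have : 0 < ‖α (r * 1)‖ := norm_pos_iff.2 h5
    rw [mul_one] at this
    linarith
  obtain ⟨m, d, hd, hαe⟩ := hα.exists_isEquivalent hα0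
  obtain ⟨k, c, hc, hβe⟩ := hβ.exists_isEquivalent hβ0
  have hlim : ∀ u : ℂ, ‖u‖ = 1 → Tendsto (fun r : ℝ => (L r * r ^ k / r ^ m : ℂ)) l
      (𝓝 (2 * d * u ^ (m + 1) / (c * u ^ k))) := by
    intro u hu
    have hu0 : u ≠ 0 := by rintro rfl; simp at hu
    have e1 : (fun r : ℝ => L r * star u * β (r * u)) ~[l] fun r => 2 * α (r * u) := by
      have := (h' u hu).trans_isBigO ((isBigO_refl (fun r : ℝ => α (r * u)) l).const_mul_right
        (c := 2) two_ne_zero)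
      exact this
    have e2 : (fun r : ℝ => α (r * u)) ~[l] fun r => d * (r * u) ^ m := hαe.comp_tendsto (hray0 u hu)
    have e3 : (fun r : ℝ => β (r * u)) ~[l] fun r => c * (r * u) ^ k := hβe.comp_tendsto (hray0 u hu)
    have e4 : (fun r : ℝ => (L r * star u) * (c * ((r : ℂ) * u) ^ k)) ~[l]
        fun r : ℝ => 2 * (d * ((r : ℂ) * u) ^ m) :=
      ((IsEquivalent.refl (u := fun r : ℝ => (L r * star u : ℂ))).mul e3).symm.trans
        (e1.trans ((IsEquivalent.refl (u := fun _ : ℝ => (2 : ℂ))).mul e2))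
    have hne' : ∀ᶠ r : ℝ in l, 2 * (d * ((r : ℂ) * u) ^ m) ≠ 0 := by
      filter_upwards [hrpos] with r hr
      have : (r : ℂ) ≠ 0 := by exact_mod_cast hr.ne'
      simp [hd, hu0, this]
    have e5 := ((isEquivalent_iff_tendsto_one hne').1 e4).mul_const
      (2 * d * u ^ (m + 1) / (c * u ^ k))
    rw [one_mul] at e5
    refine e5.congr' ?_
    filter_upwards [hrpos] with r hr
    have hr' : (r : ℂ) ≠ 0 := by exact_mod_cast hr.ne'
    have hs : star u * u = 1 := by
      rw [Complex.star_def, mul_comm, Complex.mul_conj, Complex.normSq_eq_norm_sq, hu]; norm_num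
    simp only [Pi.div_apply, mul_pow]
    field_simp
    linear_combination (L r * u ^ m : ℂ) * hs
  -- The quotient Lr^k/r^m does not involve `u`, so its limit cannot depend on `u`. With k = m + 1
  -- the quotient is rL(r), which would then converge.
  have hkm : k = m + 1 := by
    refine eq_of_forall_unit_pow_eq fun u hu => ?_
    have hu0 : u ≠ 0 := by rintro rfl; simp at hu
    have := tendsto_nhds_unique (hlim u hu) (hlim 1 h1)
    simp only [one_pow, mul_one] at this
    field_simp at this
    exact this.symm
  subst hkm
  have h2 := (hlim 1 h1).norm
  refine not_tendsto_nhds_of_tendsto_atTop hL _ (h2.congr' ?_)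
  filter_upwards [hrpos, hLpos] with r hr hLr
  rw [norm_div, norm_mul, norm_pow, norm_pow, Complex.norm_of_nonneg hr.le,
    Complex.norm_of_nonneg hLr.le, pow_succ]
  field_simp

namespace IsRadialFlat
open Filter Asymptotics

variable {P : ℂ → ℝ}

theorem fderiv_unit_mul (hP : IsRadialFlat P) :
    ∀ᶠ z in 𝓝 0, ∀ u : ℂ, ‖u‖ = 1 → ∀ v, fderiv ℝ P (z * u) v = fderiv ℝ P z (star u * v) := by
  obtain ⟨ε, hε, h⟩ := Metric.eventually_nhds_iff_ball.1
    (hP.map_unit_mul.and hP.eventually_differentiableAt)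
  filter_upwards [Metric.ball_mem_nhds (0 : ℂ) hε] with z hz u hu v
  have h1 : HasFDerivAt P (fderiv ℝ P (z * u)) (u * z) := by
    rw [mul_comm u z]
    exact (h (z * u) (by simpa [hu] using hz)).2.hasFDerivAt
  have h2 : HasFDerivAt (fun w : ℂ => u * w) (u • ContinuousLinearMap.id ℝ ℂ) z :=
    (hasFDerivAt_id z).const_mul u
  have h3 := h1.comp z h2
  have h4 : (P ∘ fun w : ℂ => u * w) =ᶠ[𝓝 z] P := by
    filter_upwards [Metric.isOpen_ball.mem_nhds hz] with w hw
    exact (h w hw).1 u hu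
  have h5 := (h3.congr_of_eventuallyEq h4.symm).unique (h z hz).2.hasFDerivAt
  have hs : u * (star u * v) = v := by
    rw [← mul_assoc, Complex.star_def, Complex.mul_conj, Complex.normSq_eq_norm_sq, hu]; norm_num
  rw [← h5]
  simp only [ContinuousLinearMap.comp_apply, smul_apply,
    ContinuousLinearMap.id_apply, smul_eq_mul]
  rw [hs]

/-- The gradient is radial. This produces the factor ū in the comparison of directions and
identifies ‖dP‖/P with |P'/P|. -/
theorem fderiv_ray (hP : IsRadialFlat P) {u : ℂ} (hu : ‖u‖ = 1) :
    ∀ᶠ r : ℝ in 𝓝[>] 0, (∀ v, fderiv ℝ P (r * u) v = (star u * v).re * fderiv ℝ P (r : ℂ) 1) ∧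
      ‖fderiv ℝ P (r * u)‖ = |fderiv ℝ P (r : ℂ) 1| := by
  filter_upwards [hP.fderiv_ofReal, (tendsto_ofReal_punctured.mono_right
    nhdsWithin_le_nhds).eventually hP.fderiv_unit_mul] with r h1 h2
  have h3 : ∀ v, fderiv ℝ P (r * u) v = (star u * v).re * fderiv ℝ P (r : ℂ) 1 := fun v => by
    rw [h2 u hu v, h1]
  refine ⟨h3, le_antisymm ?_ ?_⟩
  · refine ContinuousLinearMap.opNorm_le_bound _ (abs_nonneg _) fun v => ?_
    rw [h3, norm_mul, mul_comm]
    refine mul_le_mul_of_nonneg_left ?_ (abs_nonneg _)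
    refine (Complex.abs_re_le_norm _).trans ?_
    rw [norm_mul, norm_star, hu, one_mul]
  · have h4 := (fderiv ℝ P (r * u)).le_opNorm u
    have hs : star u * u = 1 := by
      rw [Complex.star_def, mul_comm, Complex.mul_conj, Complex.normSq_eq_norm_sq, hu]; norm_num
    rw [h3, hs, hu, mul_one, Complex.one_re, one_mul] at h4
    exact h4

end IsRadialFlat

/-! ### Induction on the order of tangency -/

namespace PreservesGraph
open Filter Asymptotics IsModelGerm

variable {P : ℂ → ℝ} {Q : ℂ → ℝ → ℝ} {F₁ F₂ : ℂ × ℂ → ℂ}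

/-- The order of tangency to the identity along `z₁ = 0` can be improved. -/
theorem coeff_eventually_zero (hF : PreservesGraph P Q F₁ F₂) (h : IsModelGerm P Q) {j : ℕ}
    (hj : 1 ≤ j)
    (hV : ∀ m < j + 1, ∀ᶠ w in 𝓝 (0 : ℂ), partialFst^[m] (fun z => F₁ z - z.1) (0, w) = 0)
    (hW : ∀ m < j, ∀ᶠ w in 𝓝 (0 : ℂ), partialFst^[m] (fun z => F₂ z - z.2) (0, w) = 0) :
    (∀ᶠ w in 𝓝 (0 : ℂ), partialFst^[j + 1] (fun z => F₁ z - z.1) (0, w) = 0) ∧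
      ∀ᶠ w in 𝓝 (0 : ℂ), partialFst^[j] (fun z => F₂ z - z.2) (0, w) = 0 := by
  by_contra hne
  have hanV : AnalyticAt ℂ (fun z : ℂ × ℂ => F₁ z - z.1) 0 := hF.analytic₁.sub analyticAt_fst
  have hanW : AnalyticAt ℂ (fun z : ℂ × ℂ => F₂ z - z.2) 0 := hF.analytic₂.sub analyticAt_snd
  have hj1 : (((j + 1).factorial : ℕ) : ℂ) ≠ 0 := by exact_mod_cast (j + 1).factorial_ne_zero
  have hj0 : ((j.factorial : ℕ) : ℂ) ≠ 0 := by exact_mod_cast j.factorial_ne_zero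
  set α : ℂ → ℂ := fun w => partialFst^[j + 1] (fun z => F₁ z - z.1) (0, w) / (j + 1).factorial
    with hα
  set β : ℂ → ℂ := fun w => partialFst^[j] (fun z => F₂ z - z.2) (0, w) / j.factorial with hβ
  have hαan : AnalyticAt ℂ α 0 :=
    (hanV.iterate_partialFst (j + 1)).comp_zero_snd.div analyticAt_const hj1
  have hβan : AnalyticAt ℂ β 0 :=
    (hanW.iterate_partialFst j).comp_zero_snd.div analyticAt_const hj0
  have hne' : ¬ ((∀ᶠ z in 𝓝 0, α z = 0) ∧ ∀ᶠ z in 𝓝 0, β z = 0) := by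
    simpa [hα, hβ, div_eq_zero_iff, hj1, hj0, Nat.factorial_ne_zero] using hne
  obtain ⟨r, hr, hrL⟩ := h.exists_seq_logDeriv_tendsto
  -- All asymptotics are taken along these radii only, where rP'/P → ∞.
  set 𝓛 : Filter ℝ := map r atTop with h𝓛
  have hle : 𝓛 ≤ 𝓝[>] 0 := hr
  set L : ℝ → ℝ := fun s => fderiv ℝ P (s : ℂ) 1 / P (s : ℂ) with hLdef
  have hL : Tendsto (fun s => s * L s) 𝓛 atTop := tendsto_map'_iff.2 hrL
  have hspos : ∀ᶠ s in 𝓛, 0 < s := hle self_mem_nhdsWithin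
  have hs1 : ∀ᶠ s in 𝓛, s < 1 := hle (Filter.mem_of_superset (Ioo_mem_nhdsGT one_pos) fun s hs => hs.2)
  have hLtop : Tendsto L 𝓛 atTop := by
    refine tendsto_atTop_mono' _ ?_ hL
    filter_upwards [hspos, hs1, hL.eventually_gt_atTop 0] with s h1 h2 h3
    have : 0 < L s := pos_of_mul_pos_right h3 h1.le
    nlinarith
  refine false_of_isLittleO_all_directions hαan hβan hne' hle hL fun u hu => ?_
  have hu0 : u ≠ 0 := by rintro rfl; simp at hu
  have hray : Tendsto (fun s : ℝ => (s : ℂ) * u) 𝓛 (𝓝[≠] 0) :=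
    (tendsto_ofReal_mul_punctured hu0).mono_left hle
  -- `G` is the combined size of the two leading terms. Since P'/P → ∞ along the radii, β alone is
  -- o(G).
  set G : ℂ → ℝ := fun z => ‖α z‖ + (P z)⁻¹ * ‖fderiv ℝ P z‖ * ‖β z‖ with hG
  set l : Filter ℂ := map (fun s : ℝ => (s : ℂ) * u) 𝓛 with hl
  have hl' : l ≤ 𝓝[≠] 0 := hray
  have hposl : ∀ᶠ z in l, 0 < P z := hl' h.eventually_pos
  have hLz : ∀ᶠ s : ℝ in 𝓛, (P ((s : ℂ) * u))⁻¹ * ‖fderiv ℝ P ((s : ℂ) * u)‖ = L s ∧ 0 < L s ∧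
      P ((s : ℂ) * u) = P (s : ℂ) := by
    filter_upwards [hle (h.fderiv_ray hu), hLtop.eventually_gt_atTop 0,
      hle ((tendsto_ofReal_punctured.mono_right nhdsWithin_le_nhds).eventually h.map_unit_mul),
      hle (tendsto_ofReal_punctured.eventually h.eventually_pos)] with s h1 h2 h3 h4
    have h5 : P ((s : ℂ) * u) = P (s : ℂ) := by rw [mul_comm]; exact h3 u hu
    refine ⟨?_, h2, h5⟩
    have h6 : 0 < fderiv ℝ P (s : ℂ) 1 := by
      have := mul_pos h2 h4
      rwa [hLdef, div_mul_cancel₀ _ h4.ne'] at this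
    rw [h1.2, h5, abs_of_pos h6, inv_mul_eq_div]
  have hGnn : ∀ᶠ z in l, 0 ≤ (P z)⁻¹ * ‖fderiv ℝ P z‖ * ‖β z‖ := by
    filter_upwards [hposl] with z hz
    positivity
  have hαG : α =O[l] G := by
    refine IsBigO.of_bound 1 ?_
    filter_upwards [hGnn] with z hz
    rw [one_mul]
    exact (le_add_of_nonneg_right hz).trans (le_abs_self _)
  have hβG : (fun z => (P z)⁻¹ * ‖fderiv ℝ P z‖ * ‖β z‖) =O[l] G := by
    refine IsBigO.of_bound 1 ?_
    filter_upwards [hGnn] with z hz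
    rw [one_mul, Real.norm_of_nonneg hz]
    exact (le_add_of_nonneg_left (norm_nonneg _)).trans (le_abs_self _)
  have hβo : β =o[l] G := by
    refine isLittleO_map.2 ?_
    have h1 : (fun s => (L s)⁻¹) =o[𝓛] fun _ => (1 : ℝ) :=
      (isLittleO_one_iff ℝ).2 hLtop.inv_tendsto_atTop
    have h2 := h1.mul_isBigO (isBigO_map.1 hβG)
    simp only [one_mul] at h2
    refine IsLittleO.of_norm_left (h2.congr' ?_ EventuallyEq.rfl)
    filter_upwards [hLz] with s hs
    simp only [Function.comp]
    rw [hs.1, inv_mul_cancel_left₀ hs.2.1.ne']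
  -- One of α, β is a nonzero germ, so `G` dominates some power of ‖z‖ and every flat error is o(G).
  have hK : ∃ K : ℕ, (fun z => ‖z‖ ^ K) =O[l] G := by
    have aux : ∀ {g : ℂ → ℂ}, AnalyticAt ℂ g 0 → (¬ ∀ᶠ z in 𝓝 0, g z = 0) → g =O[l] G →
        ∃ K : ℕ, (fun z => ‖z‖ ^ K) =O[l] G := by
      intro g hg hg0 hgG
      obtain ⟨K, c, hc, hgc⟩ := hg.exists_isEquivalent hg0
      refine ⟨K, IsBigO.trans ?_ ((hgc.isBigO_symm.mono (hl'.trans nhdsWithin_le_nhds)).trans hgG)⟩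
      refine IsBigO.of_bound ‖c‖⁻¹ (Eventually.of_forall fun z => ?_)
      have : ‖c‖ ≠ 0 := norm_ne_zero_iff.2 hc
      simp only [norm_pow, norm_norm, norm_mul]
      rw [inv_mul_cancel_left₀ this]
    rcases not_and_or.1 hne' with h1 | h1
    · exact aux hαan h1 hαG
    · exact aux hβan h1 hβo.isBigO
  obtain ⟨K, hK⟩ := hK
  have hN : (fun z => ‖z‖ ^ (K + 1)) =o[l] G := by
    have h1 : (fun z : ℂ => ‖z‖ ^ (K + 1)) =o[l] fun z : ℂ => ‖z‖ ^ K :=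
      ((isLittleO_pow_pow (Nat.lt_succ_self K)).comp_tendsto tendsto_norm_zero).mono
        (hl'.trans nhdsWithin_le_nhds)
    exact h1.trans_isBigO hK
  have hmain := sub_two_mul_isLittleO (A := fun s : ℝ => α (s * u))
    (B := fun s : ℝ => L s * star u * β (s * u)) (G := fun s : ℝ => G (s * u)) (l := 𝓛) hj ?_
  · refine hmain.congr' EventuallyEq.rfl ?_
    filter_upwards [hLz] with s hs
    simp only [hG]
    rw [hs.1, norm_mul, norm_mul, norm_star, hu, mul_one, Complex.norm_of_nonneg hs.2.1.le]
  · intro τ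
    have h1 := isLittleO_map.1 (hF.leading_eq h hj hV hW (fun _ => rfl) (fun _ => rfl) hl' hαG hβG hβo
      hN τ)
    refine h1.congr' ?_ EventuallyEq.rfl
    filter_upwards [hLz, hle (h.fderiv_ray hu)] with s hs hd
    simp only [Function.comp]
    rw [hd.1, hs.2.2]
    have e1 : (P (s : ℂ))⁻¹ * ((star u * ((-1 + (τ : ℂ) * Complex.I) ^ j * β (s * u))).re *
        fderiv ℝ P (s : ℂ) 1) =
        ((L s : ℂ) * (star u * ((-1 + (τ : ℂ) * Complex.I) ^ j * β (s * u)))).re := by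
      rw [Complex.re_ofReal_mul, hLdef]; ring
    change (_ : ℝ) + (P (s : ℂ))⁻¹ * ((star u * ((-1 + (τ : ℂ) * Complex.I) ^ j * β (s * u))).re *
        fderiv ℝ P (s : ℂ) 1) = _
    rw [e1, ← Complex.add_re]
    congr 1
    ring

/-- A graph-preserving germ tangent to the identity in `z₂` is the identity. -/
theorem eventually_eq_id (hF : PreservesGraph P Q F₁ F₂) (h : IsModelGerm P Q)
    (h1 : deriv (fun w : ℂ => F₂ (0, w)) 0 = 1) :
    ∀ᶠ z in 𝓝 (0 : ℂ × ℂ), F₁ z = z.1 ∧ F₂ z = z.2 := by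
  have hanV : AnalyticAt ℂ (fun z : ℂ × ℂ => F₁ z - z.1) 0 := hF.analytic₁.sub analyticAt_fst
  have hanW : AnalyticAt ℂ (fun z : ℂ × ℂ => F₂ z - z.2) 0 := hF.analytic₂.sub analyticAt_snd
  have hV0 : ∀ᶠ w in 𝓝 (0 : ℂ), partialFst^[0] (fun z => F₁ z - z.1) (0, w) = 0 := by
    filter_upwards [hF.eventually_fst_zero h] with w hw
    simpa using hw
  -- The first component runs one order ahead: in the equation z₁^(j+1)α balances dP(z₁^jβ), in
  -- which `dP` has the factor `P`.
  have key : ∀ n : ℕ, (∀ᶠ w in 𝓝 (0 : ℂ), partialFst^[n + 1] (fun z => F₁ z - z.1) (0, w) = 0) ∧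
      ∀ᶠ w in 𝓝 (0 : ℂ), partialFst^[n] (fun z => F₂ z - z.2) (0, w) = 0 := by
    intro n
    induction n using Nat.strong_induction_on with
    | _ n ih =>
      rcases Nat.eq_zero_or_pos n with rfl | hn
      · refine ⟨?_, ?_⟩
        · have hev : ∀ᶠ w : ℂ in 𝓝 0, AnalyticAt ℂ F₁ ((0 : ℂ), w) :=
            (Continuous.tendsto' (by fun_prop : Continuous fun w : ℂ => ((0 : ℂ), w)) 0 0
              rfl).eventually hF.analytic₁.eventually_analyticAt
          filter_upwards [hF.eventually_coeff_eq_one h h1, hev] with w hw han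
          have h2 : HasFDerivAt (fun z : ℂ × ℂ => F₁ z - z.1)
              (fderiv ℂ F₁ (0, w) - ContinuousLinearMap.fst ℂ ℂ ℂ) (0, w) :=
            han.differentiableAt.hasFDerivAt.sub hasFDerivAt_fst
          simp only [zero_add, Function.iterate_one, partialFst, h2.fderiv,
            sub_apply, ContinuousLinearMap.coe_fst']
          exact sub_eq_zero.2 hw
        · filter_upwards [hF.eventually_snd_eq h h1] with w hw
          simpa using sub_eq_zero.2 hw
      · refine hF.coeff_eventually_zero h hn (fun m hm => ?_) (fun m hm => (ih m hm).2)
        rcases m with _ | m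
        · exact hV0
        · exact (ih m (by omega)).1
  have hV := hanV.eventually_eq_zero_of_partialFst fun n => by
    rcases n with _ | n
    · exact hV0
    · exact (key n).1
  have hW := hanW.eventually_eq_zero_of_partialFst fun n => (key n).2
  filter_upwards [hV, hW] with z h2 h3
  exact ⟨sub_eq_zero.1 h2, sub_eq_zero.1 h3⟩

end PreservesGraph

/-! ### Reduction to germs and conclusion -/

open Filter in
theorem isModelGerm_of_contDiffOn {ε₀ δ₀ : ℝ} (hε₀ : 0 < ε₀) (hδ₀ : 0 < δ₀)
    {P : ℂ → ℝ} {Q : ℂ → ℝ → ℝ}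
    (hP : ContDiffOn ℝ ∞ P (Metric.ball 0 ε₀))
    (hQ : ContDiffOn ℝ ∞ (fun x : ℂ × ℝ => Q x.1 x.2)
      (Metric.ball 0 ε₀ ×ˢ Set.Ioo (-δ₀) δ₀))
    (hQ0 : Q 0 0 = 0)
    (hPrad : ∀ z ∈ Metric.ball (0 : ℂ) ε₀, P z = P ((‖z‖ : ℝ) : ℂ))
    (hQrad : ∀ z ∈ Metric.ball (0 : ℂ) ε₀, ∀ t ∈ Set.Ioo (-δ₀) δ₀,
      Q z t = Q ((‖z‖ : ℝ) : ℂ) t)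
    (hPpos : ∀ z ∈ Metric.ball (0 : ℂ) ε₀, z ≠ 0 → 0 < P z)
    (hPflat : VanishesToInfiniteOrderAt P 0) : IsModelGerm P Q := by
  have hb : Metric.ball (0 : ℂ) ε₀ ∈ 𝓝 0 := Metric.ball_mem_nhds _ hε₀
  have hprod : (Metric.ball (0 : ℂ) ε₀ ×ˢ Set.Ioo (-δ₀) δ₀) ∈ 𝓝 ((0 : ℂ), (0 : ℝ)) :=
    prod_mem_nhds hb (Ioo_mem_nhds (by linarith) hδ₀)
  refine ⟨⟨hP.contDiffAt hb, hPflat, ?_, ?_⟩, hQ0, ?_, ?_⟩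
  · filter_upwards [hb] with z hz using hPrad z hz
  · filter_upwards [hb] with z hz using hPpos z hz
  · have h1 : ContDiffAt ℝ 1 (fun x : ℂ × ℝ => Q x.1 x.2) (0, 0) :=
      contDiffAt_infty.1 (hQ.contDiffAt hprod) 1
    obtain ⟨K, t, ht, hK⟩ := h1.exists_lipschitzOnWith
    refine ⟨K, ?_⟩
    have h2 : t ×ˢ t ∈ 𝓝 (((0 : ℂ), (0 : ℝ)), ((0 : ℂ), (0 : ℝ))) := prod_mem_nhds ht ht
    filter_upwards [h2] with x hx
    exact hK.norm_sub_le hx.1 hx.2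
  · have h3 : (Metric.ball (0 : ℂ) ε₀ ×ˢ Set.Ioo (-δ₀) δ₀) ∈ 𝓝 (0 : ℂ × ℝ) := hprod
    filter_upwards [h3] with x hx using hQrad x.1 hx.1 x.2 hx.2

open Filter in
theorem eventually_mem_graphHypersurface_iff {ε₀ δ₀ : ℝ} (hε₀ : 0 < ε₀) (hδ₀ : 0 < δ₀)
    (P : ℂ → ℝ) (Q : ℂ → ℝ → ℝ) :
    ∀ᶠ z in 𝓝 (0 : ℂ × ℂ), z ∈ graphHypersurface ε₀ δ₀ P Q ↔ graphFunction P Q z = 0 := by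
  have h1 : Tendsto (fun z : ℂ × ℂ => ‖z.2‖) (𝓝 0) (𝓝 0) :=
    Continuous.tendsto' (by fun_prop) _ _ (by simp)
  have h2 : Tendsto (fun z : ℂ × ℂ => |z.1.im|) (𝓝 0) (𝓝 0) :=
    Continuous.tendsto' (by fun_prop) _ _ (by simp)
  filter_upwards [h1.eventually_lt_const hε₀, h2.eventually_lt_const hδ₀] with z hz1 hz2
  exact ⟨fun h => h.2.2, fun h => ⟨hz1, hz2, h⟩⟩

namespace PreservesGraph
open Filter

variable {P : ℂ → ℝ} {Q : ℂ → ℝ → ℝ} {F₁ F₂ : ℂ × ℂ → ℂ}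

/-- Radiality of `P` and `Q` lets a rotation normalise φ'(0) to 1. -/
theorem unit_mul_snd (hF : PreservesGraph P Q F₁ F₂) (h : IsModelGerm P Q) {u : ℂ}
    (hu : ‖u‖ = 1) : PreservesGraph P Q F₁ (fun z => u * F₂ z) where
  analytic₁ := hF.analytic₁
  analytic₂ := analyticAt_const.mul hF.analytic₂
  map_zero₁ := hF.map_zero₁
  map_zero₂ := by simp [hF.map_zero₂]
  maps := by
    have him : Tendsto (fun z => (F₁ z).im) (𝓝 0) (𝓝 0) :=
      (Complex.continuous_im.tendsto' 0 0 rfl).comp hF.tendsto₁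
    have hu2 : Tendsto (fun z => u * F₂ z) (𝓝 0) (𝓝 0) := by simpa using hF.tendsto₂.const_mul u
    filter_upwards [hF.maps, hF.tendsto₂.eventually h.map_unit_mul,
      (hF.tendsto₂.prodMk_nhds him).eventually h.radial₂,
      (hu2.prodMk_nhds him).eventually h.radial₂] with z h1 h2 h3 h4 h5
    have h6 := h1 h5
    simp only [graphFunction] at h6 ⊢
    rw [h2 u hu, h4, norm_mul, hu, one_mul, ← h3]
    exact h6

/-- A nondegenerate graph-preserving germ is a rotation. -/
theorem exists_eventually_eq_rotation (hF : PreservesGraph P Q F₁ F₂) (h : IsModelGerm P Q)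
    (h0 : partialFst F₁ 0 ≠ 0) :
    ∃ t : ℝ, ∀ᶠ z in 𝓝 (0 : ℂ × ℂ), (F₁ z, F₂ z) = rotationMap t z := by
  set b := deriv (fun w : ℂ => F₂ (0, w)) 0 with hb
  have hb1 : ‖b‖ = 1 := hF.norm_deriv_snd_eq_one h h0
  have hb0 : b ≠ 0 := by intro h; simp [h] at hb1
  have hF' := hF.unit_mul_snd h (u := b⁻¹) (by rw [norm_inv, hb1, inv_one])
  have hd : deriv (fun w : ℂ => b⁻¹ * F₂ (0, w)) 0 = 1 := by
    rw [deriv_const_mul _ hF.analytic₂.comp_zero_snd.differentiableAt, ← hb, inv_mul_cancel₀ hb0]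
  obtain ⟨t, ht⟩ := (Complex.norm_eq_one_iff b).1 hb1
  refine ⟨t, ?_⟩
  filter_upwards [hF'.eventually_eq_id h hd] with z hz
  have h2 : F₂ z = b * z.2 := by
    rw [← hz.2, mul_inv_cancel_left₀ hb0]
  rw [rotationMap, hz.1, h2, ← ht, mul_comm (t : ℂ)]

/-- F₁(0,·) = 0 already removes the z₂-derivative. If the z₁-derivative vanished too, F₁∘g would
have zero differential, although it equals z₁. -/
theorem partialFst_ne_zero (hF : PreservesGraph P Q F₁ F₂) (h : IsModelGerm P Q)
    {g : ℂ × ℂ → ℂ × ℂ} (hg : AnalyticAt ℂ g 0) (hg0 : g 0 = 0)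
    (hinv : ∀ᶠ w in 𝓝 0, F₁ (g w) = w.1) : partialFst F₁ 0 ≠ 0 := by
  intro h0
  have h1 : HasFDerivAt F₁ (fderiv ℂ F₁ 0) (g 0) := by
    rw [hg0]; exact hF.analytic₁.differentiableAt.hasFDerivAt
  have h2 : fderiv ℂ F₁ 0 = 0 := by
    have h3 : fderiv ℂ F₁ 0 (0, 1) = 0 := by
      have h4 : HasDerivAt (fun w : ℂ => ((0 : ℂ), w)) (0, 1) 0 :=
        (hasDerivAt_const _ _).prodMk (hasDerivAt_id _)
      have h5 : HasFDerivAt F₁ (fderiv ℂ F₁ 0) ((0 : ℂ), (0 : ℂ)) :=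
        hF.analytic₁.differentiableAt.hasFDerivAt
      have h6 := h5.comp_hasDerivAt (0 : ℂ) h4
      refine (h6.congr_of_eventuallyEq ?_).unique (hasDerivAt_const (0 : ℂ) (0 : ℂ))
      filter_upwards [hF.eventually_fst_zero h] with w hw
      simpa using hw.symm
    ext
    · simpa [partialFst] using h0
    · simpa using h3
  rw [h2] at h1
  have h3 := h1.comp (0 : ℂ × ℂ) hg.differentiableAt.hasFDerivAt
  have h4 : HasFDerivAt (F₁ ∘ g) (ContinuousLinearMap.fst ℂ ℂ ℂ) 0 :=
    hasFDerivAt_fst.congr_of_eventuallyEq hinv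
  have h5 := congrArg (fun T : ℂ × ℂ →L[ℂ] ℂ => T (1, 0)) (h3.unique h4)
  simp at h5

end PreservesGraph

theorem rotationMap_neg_comp (t : ℝ) (z : ℂ × ℂ) : rotationMap (-t) (rotationMap t z) = z := by
  simp only [rotationMap]
  rw [← mul_assoc, ← Complex.exp_add]
  simp

theorem rotationMap_mem_graphHypersurface {ε₀ δ₀ : ℝ} {P : ℂ → ℝ} {Q : ℂ → ℝ → ℝ}
    (hPrad : ∀ z ∈ Metric.ball (0 : ℂ) ε₀, P z = P ((‖z‖ : ℝ) : ℂ))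
    (hQrad : ∀ z ∈ Metric.ball (0 : ℂ) ε₀, ∀ t ∈ Set.Ioo (-δ₀) δ₀,
      Q z t = Q ((‖z‖ : ℝ) : ℂ) t) (t : ℝ) {z : ℂ × ℂ} (hz : z ∈ graphHypersurface ε₀ δ₀ P Q) :
    rotationMap t z ∈ graphHypersurface ε₀ δ₀ P Q := by
  obtain ⟨h1, h2, h3⟩ := hz
  have hn : ‖Complex.exp (Complex.I * t) * z.2‖ = ‖z.2‖ := by
    rw [norm_mul, mul_comm Complex.I, Complex.norm_exp_ofReal_mul_I, one_mul]
  have hm : z.2 ∈ Metric.ball (0 : ℂ) ε₀ := by simpa using h1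
  have hm' : Complex.exp (Complex.I * t) * z.2 ∈ Metric.ball (0 : ℂ) ε₀ := by
    rw [mem_ball_zero_iff, hn]; exact h1
  have ht : z.1.im ∈ Set.Ioo (-δ₀) δ₀ := abs_lt.1 h2
  refine ⟨by simpa only [rotationMap, hn] using h1, h2, ?_⟩
  simp only [rotationMap]
  rw [hPrad _ hm', hQrad _ hm' _ ht, hn, ← hPrad _ hm, ← hQrad _ hm _ ht]
  exact h3

theorem isLocalBiholomorphismAt_rotationMap (t : ℝ) :
    IsLocalBiholomorphismAt (rotationMap t) 0 := by
  have han : ∀ (t : ℝ) (z : ℂ × ℂ), AnalyticAt ℂ (rotationMap t) z := fun t z =>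
    analyticAt_fst.prod (analyticAt_const.mul analyticAt_snd)
  refine ⟨han t 0, rotationMap (-t), han _ _, ?_, ?_⟩
  · exact Filter.Eventually.of_forall fun z => rotationMap_neg_comp t z
  · exact Filter.Eventually.of_forall fun z => by simpa using rotationMap_neg_comp (-t) z

theorem theoremB (ε₀ δ₀ : ℝ) (hε₀ : 0 < ε₀) (hδ₀ : 0 < δ₀)
    (P : ℂ → ℝ) (Q : ℂ → ℝ → ℝ)
    (hP : ContDiffOn ℝ ∞ P (Metric.ball 0 ε₀))
    (hQ : ContDiffOn ℝ ∞ (fun x : ℂ × ℝ => Q x.1 x.2)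
      (Metric.ball 0 ε₀ ×ˢ Set.Ioo (-δ₀) δ₀))
    (hP0 : P 0 = 0) (hQ0 : Q 0 0 = 0)
    (hPrad : ∀ z ∈ Metric.ball (0 : ℂ) ε₀, P z = P ((‖z‖ : ℝ) : ℂ))
    (hQrad : ∀ z ∈ Metric.ball (0 : ℂ) ε₀, ∀ t ∈ Set.Ioo (-δ₀) δ₀,
      Q z t = Q ((‖z‖ : ℝ) : ℂ) t)
    (hPpos : ∀ z ∈ Metric.ball (0 : ℂ) ε₀, z ≠ 0 → 0 < P z)
    (hPflat : VanishesToInfiniteOrderAt P 0) :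
    stabilityGroup (graphHypersurface ε₀ δ₀ P Q) 0 =
      Set.range fun t : ℝ => (rotationMap t : (𝓝 (0 : ℂ × ℂ)).Germ (ℂ × ℂ)) := by
  have hmodel : IsModelGerm P Q :=
    isModelGerm_of_contDiffOn hε₀ hδ₀ hP hQ hQ0 hPrad hQrad hPpos hPflat
  have hmem := eventually_mem_graphHypersurface_iff hε₀ hδ₀ P Q
  ext F
  constructor
  · rintro ⟨f, rfl, ⟨hf, g, hg, hgf, hfg⟩, hf0, hmaps⟩
    rw [hf0] at hg hfg
    have hg0 : g 0 = 0 := by simpa [hf0] using hgf.self_of_nhds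
    have hft : Filter.Tendsto f (𝓝 0) (𝓝 0) := by
      have := hf.continuousAt.tendsto
      rwa [hf0] at this
    have hF : PreservesGraph P Q (fun z => (f z).1) (fun z => (f z).2) :=
      { analytic₁ := analyticAt_fst.comp hf
        analytic₂ := analyticAt_snd.comp hf
        map_zero₁ := by simp [hf0]
        map_zero₂ := by simp [hf0]
        maps := by
          filter_upwards [hmem, hft.eventually hmem, hmaps] with z h1 h2 h3 h4
          exact h2.1 (h3 (h1.2 h4)) }
    obtain ⟨t, ht⟩ := hF.exists_eventually_eq_rotation hmodel
      (hF.partialFst_ne_zero hmodel hg hg0 (hfg.mono fun w hw => by rw [hw]))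
    exact ⟨t, Filter.Germ.coe_eq.2 (ht.mono fun z hz => hz.symm)⟩
  · rintro ⟨t, rfl⟩
    refine ⟨rotationMap t, rfl, isLocalBiholomorphismAt_rotationMap t, by simp [rotationMap], ?_⟩
    exact Filter.Eventually.of_forall fun z hz =>
      rotationMap_mem_graphHypersurface hPrad hQrad t hz
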